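/- Let $n\ge 0$, let $\mathbb{C}[x]=\mathbb{C}[x_{ij}\mid 1\le i<j\le n]$ (with $x_{ji}:=x_{ij}$), and let $I_n$ be the kernel of $\mathbb{C}[x]\to\mathbb{C}[t_1,\dots,t_n]$, $x_{ij}\mapsto t_it_j$, i.e. the toric ideal of the second hypersimplex $\Delta(2,n)$. For an ideal $I$ of a polynomial ring $K[x]$ over a field, the secant ideal $I^{\{r\}}$ is the ideal of all $f\in K[x]$ such that $f(y_1+\cdots+y_r)\in I(y_1)+\cdots+I(y_r)$, where $y_1,\dots,y_r$ are disjoint copies of the variables $x$ and $I(y_a)$ is the ideal generated by the copy of $I$ in the variables $y_a$. A term order $\prec$ is $r$-delightful for $I$ if $\mathrm{in}_\prec(I^{\{r\}})=\mathrm{in}_\prec(I)^{\{r\}}$. Place $1,\dots,n$ in this order on a circle as the vertices of a regular $n$-gon, and let the class of the edge $ij$ ($i<j$) be $\min(j-i,\,n-(j-i))$. A circular term order is a term order on $\mathbb{C}[x]$ that is a block (product) order with these classes of variables as blocks, the variables of smaller class being larger: two monomials are compared by their parts in the smallest class in which they differ, and within a class the order is arbitrary. Let $k\ge 1$. Sequences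 $\mathbf{i}=(i_1,\dots,i_{2k+1})$, $\mathbf{j}=(j_1,\dots,j_{2k+1})$ in $\{1,\dots,n\}$, with indices read modulo $2k+1$, are admissible if $i_1\le j_1<i_2\le j_2<\cdots<i_{2k+1}\le j_{2k+1}<i_1$ holds circularly, making exactly one full revolution around the circle, and $i_l\ne j_{l+k-1}$ for all $l$ (this is automatic for $k\ge2$, and means $i_l\neq j_l$ for $k=1$). Regard the $i_l$ and $j_l$ as $4k+2$ formally distinct symbols, and let $Z_{\mathbf{i},\mathbf{j}}\cong\mathbb{Z}_2^{2k+1}$ be the group generated by the $2k+1$ disjoint transpositions $(i_l\ j_{l-1})$. The master polynomial is $$f_{\mathbf{i},\mathbf{j}}=\sum_{\sigma\in Z_{\mathbf{i},\mathbf{j}}}(-1)^\sigma\prod_{l=1}^{2k+1}x_{\sigma(i_l)\,\sigma(j_{l+k-1})},$$ where $(-1)^\sigma$ is the sign of $\sigma$ and, after applying $\sigma$, each symbol is replaced by its value. A $3\times3$ off-diagonal minor is a minor $\det(x_{ab})_{a\in A,\,b\in B}$ with disjoint $A,B\subseteq\{1,\dots,n\}$, $|A|=|B|=3$. **Theorem.**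 Every circular term order $\prec$ is $2$-delightful for $I_n$, i.e. $\mathrm{in}_\prec(I_n^{\{2\}})=\mathrm{in}_\prec(I_n)^{\{2\}}$, and the finite set consisting of all master polynomials $f_{\mathbf{i},\mathbf{j}}$ and all $3\times3$ off-diagonal minors is a Gröbner basis of $I_n^{\{2\}}$ with respect to $\prec$. The degrees of the elements of this Gröbner basis are exactly the odd integers $d$ with $3\le d\le n$, except that $d=3$ does not occur if $n\le5$. (So for $n\ge 6$ all odd degrees from $3$ up to $n$ occur.) -/

import Mathlib

open scoped MonomialOrder

noncomputable section

namespace SecondHypersimplex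

open MvPolynomial

section General

variable {σ K : Type*} [Field K]

/-- The `r`-th secant ideal of an ideal `I` of `K[x]`. In the polynomial ring in `r` disjoint copies
`y_1, …, y_r` of the variables take the ideal `I(y_1) + ⋯ + I(y_r)`, add the linear relations
`x = y_1 + ⋯ + y_r`, and eliminate the `y`'s. Eliminating `x` by means of the linear relations, this
is the ideal of all `f` with `f(y_1 + ⋯ + y_r) ∈ I(y_1) + ⋯ + I(y_r)`, i.e. the kernel of
`K[x] → K[x]/I ⊗ ⋯ ⊗ K[x]/I`. -/
def secantIdeal (r : ℕ) (I : Ideal (MvPolynomial σ K)) : Ideal (MvPolynomial σ K) :=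
  Ideal.comap
    (aeval (fun s : σ => ∑ a : Fin r, (X (a, s) : MvPolynomial (Fin r × σ) K)) :
      MvPolynomial σ K →ₐ[K] MvPolynomial (Fin r × σ) K)
    (⨆ a : Fin r, I.map (rename (fun s : σ => (a, s)) :
      MvPolynomial σ K →ₐ[K] MvPolynomial (Fin r × σ) K))

/-- The initial ideal of `I`, generated by the leading terms of all elements of `I`. -/
def initialIdeal (m : MonomialOrder σ) (I : Ideal (MvPolynomial σ K)) : Ideal (MvPolynomial σ K) :=
  Ideal.span (m.leadingTerm '' (I : Set (MvPolynomial σ K)))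

/-- `G` is a (finite) Gröbner basis of `I`. -/
def IsGroebnerBasis (m : MonomialOrder σ) (G : Set (MvPolynomial σ K))
    (I : Ideal (MvPolynomial σ K)) : Prop :=
  G.Finite ∧ G ⊆ (I : Set (MvPolynomial σ K)) ∧
    Ideal.span (m.leadingTerm '' G) = initialIdeal m I

/-- The term order `m` is `r`-delightful for `I`. -/
def IsDelightful (m : MonomialOrder σ) (r : ℕ) (I : Ideal (MvPolynomial σ K)) : Prop :=
  initialIdeal m (secantIdeal r I) = secantIdeal r (initialIdeal m I)

/-- `m` is a block (product) order for the partition of the variables into the blocks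
`{s | blk s = c}`, `c = 0, 1, 2, …`, the variables of the blocks with small index being large:
two monomials are compared by their parts in the first block in which they differ.
In particular `x_s ≻ x_t` whenever `blk s < blk t`. Inside a block the order is arbitrary. -/
def IsBlockOrder (m : MonomialOrder σ) (blk : σ → ℕ) : Prop :=
  ∀ (c : ℕ) (u v : σ →₀ ℕ), (∀ s, blk s < c → u s = v s) →
    u.filter (fun s => blk s = c) ≺[m] v.filter (fun s => blk s = c) → u ≺[m] v

end General

/-- The edges `ij`, `i < j`, of the complete graph `K_n`. -/
abbrev Edge (n : ℕ) : Type := {p : Fin n × Fin n // p.1 < p.2}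

/-- The variable `x_{ab} = x_{ba}`. (The value at `a = b` is irrelevant.) -/
def x {n : ℕ} (a b : Fin n) : MvPolynomial (Edge n) ℂ :=
  if h : a < b then X ⟨(a, b), h⟩ else if h : b < a then X ⟨(b, a), h⟩ else 0

/-- The homomorphism `φ_n : ℂ[x] → ℂ[t]`, `x_{ij} ↦ t_i t_j`. -/
def toricMap (n : ℕ) : MvPolynomial (Edge n) ℂ →ₐ[ℂ] MvPolynomial (Fin n) ℂ :=
  aeval (fun e => X e.1.1 * X e.1.2)

/-- The toric ideal `I_n` of the second hypersimplex. -/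
def toricIdeal (n : ℕ) : Ideal (MvPolynomial (Edge n) ℂ) := RingHom.ker (toricMap n)

/-- The class of an edge of the regular `n`-gon: the length of the shorter of the two boundary
paths joining its end points. Two edges are in the same orbit of the dihedral group if and only if
these numbers agree, and edges near the boundary have small class. -/
def edgeClass {n : ℕ} (e : Edge n) : ℕ :=
  min (e.1.2.val - e.1.1.val) (n - (e.1.2.val - e.1.1.val))

/-- A circular term order: a block order on the monomials of `ℂ[x]` whose blocks are the dihedral
classes of edges, with the variables of smaller classes larger. -/
def IsCircular {n : ℕ} (m : MonomialOrder (Edge n)) : Prop := IsBlockOrder m edgeClass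

/-- `l ↦ l + k` on indices modulo `2k + 1`. (The entries of the sequences `i`, `j` of length
`2k + 1` are numbered `0, …, 2k`, and their indices are read modulo `2k + 1`.) -/
def shift (k : ℕ) (l : Fin (2 * k + 1)) : Fin (2 * k + 1) := l + Fin.ofNat (2 * k + 1) k

/-- The pair `i, j` of sequences of length `2k + 1 ≥ 3` of vertices of the `n`-gon is admissible:
`i_0 ≤ j_0 < i_1 ≤ j_1 < ⋯ < i_{2k} ≤ j_{2k} < i_0` in circular order, making exactly one
full revolution around the circle; and all the pairs `{i_l, j_{l+k-1}}` are edges (this is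
automatic for `k ≥ 2`, and says `i_l ≠ j_l` for `k = 1`).
The subtraction of `Fin n` is modulo `n`: `(p - i 0).val` is the number of steps from `i_0` to `p`
around the circle in the positive direction. -/
structure IsAdmissible {n : ℕ} (k : ℕ) (i j : Fin (2 * k + 1) → Fin n) : Prop where
  one_le : 1 ≤ k
  i_le_j : ∀ l, (i l - i 0).val ≤ (j l - i 0).val
  j_lt_i : ∀ l l', l < l' → (j l - i 0).val < (i l' - i 0).val
  isEdge : ∀ l, i l ≠ j (shift k l - 1)

/-- The master polynomial `f_{i,j} = ∑_σ (-1)^σ ∏_l x_{σ(i_l) σ(j_{l+k-1})}`, where `σ` runs over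
the group generated by the `2k + 1` commuting disjoint transpositions `(i_l j_{l-1})` of the
symbols `i_l`, `j_l` (formally distinct symbols, also where their values coincide).
Its elements are the products `σ_S = ∏_{l ∈ S} (i_l j_{l-1})` over all sets `S` of indices;
the sign of `σ_S` is `(-1)^|S|`; `σ_S` maps `i_l` to `j_{l-1}` if `l ∈ S` and to `i_l`
otherwise, and it maps `j_{l+k-1}` to `i_{l+k}` if `l + k ∈ S` and to `j_{l+k-1}` otherwise. -/
def masterPolynomial {n : ℕ} (k : ℕ) (i j : Fin (2 * k + 1) → Fin n) :
    MvPolynomial (Edge n) ℂ :=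
  ∑ S : Finset (Fin (2 * k + 1)), (-1) ^ S.card *
    ∏ l, x (if l ∈ S then j (l - 1) else i l)
           (if shift k l ∈ S then i (shift k l) else j (shift k l - 1))

/-- The set of all master polynomials. -/
def masterPolynomials (n : ℕ) : Set (MvPolynomial (Edge n) ℂ) :=
  {f | ∃ (k : ℕ) (i j : Fin (2 * k + 1) → Fin n),
    IsAdmissible k i j ∧ f = masterPolynomial k i j}

/-- The set of all `3 × 3` off-diagonal minors: the minors, of size `3`, of the symmetric matrix
`(x_{ab})` whose row set and column set are disjoint. -/
def offDiagonalMinors (n : ℕ) : Set (MvPolynomial (Edge n) ℂ) :=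
  {f | ∃ a b : Fin 3 → Fin n, StrictMono a ∧ StrictMono b ∧ (∀ s t, a s ≠ b t) ∧
    f = (Matrix.of fun s t => x (a s) (b t)).det}

end SecondHypersimplex

end

noncomputable section

namespace SecondHypersimplex

open MvPolynomial

/-! Call a multigraph standard (`Std`) if no two of its edges are separated (`Sep`). Replacing two
separated edges by the crossing pair on the same four vertices keeps all degrees and lowers the
monomial in every circular order. A standard multigraph is determined by its degrees
(`Std.eq_of_vdeg_eq`), hence is the minimum of its fibre under the toric map, and the standard
monomials of `I_n` are exactly the standard multigraphs.

In characteristic zero `f(y_0 + y_1)` contains `y_0^a y_1^b` if and only if `f` contains `x^(a+b)`.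
Hence `in(I_n)^{2}` is spanned by the monomials that are not products of two standard ones, and
minimality in fibres shows that leading monomials of `I_n^{2}` are of this kind
(`not_std_of_mem_secantIdeal`). Both claims about `≺` then follow once every such monomial is
divisible by the leading monomial of a listed polynomial (`exists_degree_le`).

If `u` is not a sum of two standard multigraphs, the graph of separation on its support is not
bipartite and has an induced odd cycle. Three pairwise separated edges either cut off three disjoint
arcs, giving a master polynomial with `k = 1`, or one lies between the other two, giving a minor.
For a cycle of length `2k + 1 ≥ 5` every edge bounds an arc such that exactly the consecutive arcs
are disjoint; the starts of these arcs run around the circle in index steps of two, which yields an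
admissible pair (`ArcSystem.isAdmissible`) whose leading monomial is the product of the edges of the
cycle.

The listed polynomials lie in `I_n^{2}` because there `x_ab` becomes a pairing of vectors in a
plane: 3 × 3 minors vanish, and a master polynomial is an odd closed chain of antisymmetric forms.
Its leading term is the one for `S = ∅`, since each transposition widens the arcs it touches. -/

/-- Two edges are disjoint and do not cross, the vertices being placed in order on a circle. -/
def Sep {n : ℕ} (e f : Edge n) : Prop :=
  e.1.2 < f.1.1 ∨ f.1.2 < e.1.1 ∨ (e.1.1 < f.1.1 ∧ f.1.2 < e.1.2) ∨
    (f.1.1 < e.1.1 ∧ e.1.2 < f.1.2)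

lemma Sep.symm {n : ℕ} {e f : Edge n} (h : Sep e f) : Sep f e := by
  unfold Sep at *; tauto

lemma Sep.irrefl {n : ℕ} (e : Edge n) : ¬ Sep e e := by
  have := e.2
  unfold Sep; grind

/-- No two edges in the support are disjoint and noncrossing. -/
def Std {n : ℕ} (u : Edge n →₀ ℕ) : Prop := ∀ e f, u e ≠ 0 → u f ≠ 0 → ¬ Sep e f

/-! ### Degree sequences, and standard multigraphs as minima of their fibres -/

/-- The degree sequence of a multigraph. -/
def vdeg {n : ℕ} : (Edge n →₀ ℕ) →+ (Fin n →₀ ℕ) :=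
  Finsupp.liftAddHom fun e => Finsupp.singleAddHom e.1.1 + Finsupp.singleAddHom e.1.2

lemma vdeg_single {n : ℕ} (e : Edge n) (k : ℕ) :
    vdeg (Finsupp.single e k) = Finsupp.single e.1.1 k + Finsupp.single e.1.2 k := by
  simp [vdeg]

lemma sum_vdeg_mul {n : ℕ} (u : Edge n →₀ ℕ) (w : Fin n → ℤ) :
    ∑ i, (vdeg u i : ℤ) * w i = ∑ e, (u e : ℤ) * (w e.1.1 + w e.1.2) := by
  induction u using Finsupp.induction_linear with
  | zero => simp
  | add f g hf hg => simp [add_mul, Finset.sum_add_distrib, hf, hg]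
  | single e k =>
    simp [vdeg_single, add_mul, Finset.sum_add_distrib, Finsupp.single_apply, mul_add]

/-- The number of edges with both end points in `[p, q)`. -/
def edgesIn {n : ℕ} (u : Edge n →₀ ℕ) (p q : ℕ) : ℤ :=
  ∑ e, (u e : ℤ) * if p ≤ e.1.1.val ∧ e.1.2.val < q then 1 else 0

/-- An edge inside `[p, q)` and an edge outside are separated, so for a standard multigraph one of
the two counts vanishes. The degrees determine the difference of the counts, through the weight 1
inside and -1 outside, and hence both of them. -/
lemma Std.edgesIn_eq {n : ℕ} {u v : Edge n →₀ ℕ} (hu : Std u) (hv : Std v)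
    (h : vdeg u = vdeg v) (p q : ℕ) : edgesIn u p q = edgesIn v p q := by
  let w : Fin n → ℤ := fun i => if p ≤ i.val ∧ i.val < q then 1 else -1
  let o : Edge n → ℤ := fun e =>
    if ¬ (p ≤ e.1.1.val ∧ e.1.1.val < q) ∧ ¬ (p ≤ e.1.2.val ∧ e.1.2.val < q) then 1 else 0
  have key : ∀ u : Edge n →₀ ℕ, ∑ i, (vdeg u i : ℤ) * w i =
      2 * edgesIn u p q - 2 * ∑ e, (u e : ℤ) * o e := by
    intro u
    rw [sum_vdeg_mul, edgesIn, Finset.mul_sum, Finset.mul_sum, ← Finset.sum_sub_distrib]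
    refine Finset.sum_congr rfl fun e _ => ?_
    have he : e.1.1.val < e.1.2.val := e.2
    rw [mul_left_comm, mul_left_comm (2 : ℤ), ← mul_sub]
    congr 1
    simp only [w, o]
    split_ifs <;> omega
  have dich : ∀ u : Edge n →₀ ℕ, Std u → 0 ≤ edgesIn u p q ∧ 0 ≤ ∑ e, (u e : ℤ) * o e ∧
      (edgesIn u p q = 0 ∨ ∑ e, (u e : ℤ) * o e = 0) := by
    intro u hu
    refine ⟨Finset.sum_nonneg fun e _ => by positivity, Finset.sum_nonneg fun e _ => ?_, ?_⟩
    · simp only [o]; positivity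
    · by_contra! hcon
      obtain ⟨e, -, he⟩ := Finset.exists_ne_zero_of_sum_ne_zero hcon.1
      obtain ⟨f, -, hf⟩ := Finset.exists_ne_zero_of_sum_ne_zero hcon.2
      simp only [o, ne_eq, mul_eq_zero, Nat.cast_eq_zero, ite_eq_right_iff, one_ne_zero,
        imp_false, not_or, not_not] at he hf
      refine hu e f he.1 hf.1 ?_
      have h1 : e.1.1.val < e.1.2.val := e.2
      have h2 : f.1.1.val < f.1.2.val := f.2
      simp only [Sep, Fin.lt_def]
      omega
  have h1 := key u
  have h2 := key v
  rw [h] at h1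
  have := dich u hu
  have := dich v hv
  omega

/-- Inclusion-exclusion: a multiplicity is a mixed second difference of interval counts. -/
lemma apply_eq_edgesIn {n : ℕ} (u : Edge n →₀ ℕ) (e : Edge n) :
    (u e : ℤ) = edgesIn u e.1.1 (e.1.2 + 1) - edgesIn u (e.1.1 + 1) (e.1.2 + 1)
      - edgesIn u e.1.1 e.1.2 + edgesIn u (e.1.1 + 1) e.1.2 := by
  have : (u e : ℤ) = ∑ f, (u f : ℤ) * if f = e then 1 else 0 := by simp
  rw [this]
  simp only [edgesIn]
  rw [← Finset.sum_sub_distrib, ← Finset.sum_sub_distrib, ← Finset.sum_add_distrib]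
  refine Finset.sum_congr rfl fun f _ => ?_
  rw [← mul_sub, ← mul_sub, ← mul_add]
  congr 1
  simp only [Subtype.ext_iff, Prod.ext_iff, Fin.ext_iff]
  split_ifs <;> omega

/-- A multigraph with pairwise touching or crossing edges is determined by its degrees. -/
lemma Std.eq_of_vdeg_eq {n : ℕ} {u v : Edge n →₀ ℕ} (hu : Std u) (hv : Std v)
    (h : vdeg u = vdeg v) : u = v := by
  ext e
  have h1 := apply_eq_edgesIn u e
  have h2 := apply_eq_edgesIn v e
  simp only [hu.edgesIn_eq hv h] at h1
  omega

lemma IsBlockOrder.lt {σ : Type*} {m : MonomialOrder σ} {blk : σ → ℕ} (hm : IsBlockOrder m blk)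
    (c : ℕ) {u v : σ →₀ ℕ} (h1 : ∀ s, blk s < c → u s = v s) (h2 : ∀ s, blk s = c → u s ≤ v s)
    (h3 : ∃ s, blk s = c ∧ u s < v s) : u ≺[m] v := by
  refine hm c u v h1 (m.toSyn_strictMono (lt_of_le_of_ne ?_ ?_))
  · intro s
    by_cases hs : blk s = c
    · simpa [hs] using h2 s hs
    · simp [hs]
  · obtain ⟨s, hs, hlt⟩ := h3
    intro heq
    have := DFunLike.congr_fun heq s
    simp [hs] at this
    omega

/-- Replacing two noncrossing edges by the two crossing edges makes a monomial smaller. -/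
lemma IsCircular.crossing_lt {n : ℕ} {m : MonomialOrder (Edge n)} (hm : IsCircular m)
    {e f e' f' : Edge n} (h1 : min (edgeClass e) (edgeClass f) < edgeClass e')
    (h2 : min (edgeClass e) (edgeClass f) < edgeClass f') :
    Finsupp.single e' 1 + Finsupp.single f' 1 ≺[m] Finsupp.single e 1 + Finsupp.single f 1 := by
  classical
  refine hm.lt (min (edgeClass e) (edgeClass f)) ?_ ?_ ?_
  · intro s hs
    have a1 : e' ≠ s := by rintro rfl; omega
    have a2 : f' ≠ s := by rintro rfl; omega
    have a3 : e ≠ s := by rintro rfl; omega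
    have a4 : f ≠ s := by rintro rfl; omega
    simp [a1, a2, a3, a4]
  · intro s hs
    have a1 : e' ≠ s := by rintro rfl; omega
    have a2 : f' ≠ s := by rintro rfl; omega
    simp [a1, a2]
  · rcases le_total (edgeClass e) (edgeClass f) with h | h
    · refine ⟨e, by omega, ?_⟩
      have a1 : e' ≠ e := by rintro rfl; omega
      have a2 : f' ≠ e := by rintro rfl; omega
      simp [a1, a2]
    · refine ⟨f, by omega, ?_⟩
      have a1 : e' ≠ f := by rintro rfl; omega
      have a2 : f' ≠ f := by rintro rfl; omega
      simp [a1, a2]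

/-- Either arc cut off by a diagonal of a quadrilateral properly contains an arc cut off by one of
two given opposite sides. So the class of a diagonal exceeds the smaller class of these sides. -/
lemma exists_crossing {n : ℕ} {e f : Edge n} (h : Sep e f) :
    ∃ e' f' : Edge n, vdeg (Finsupp.single e' 1 + Finsupp.single f' 1) =
        vdeg (Finsupp.single e 1 + Finsupp.single f 1) ∧
      min (edgeClass e) (edgeClass f) < edgeClass e' ∧
      min (edgeClass e) (edgeClass f) < edgeClass f' := by
  obtain ⟨⟨a, b⟩, hab⟩ := e
  obtain ⟨⟨c, d⟩, hcd⟩ := f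
  simp only [Sep, Fin.lt_def] at h
  simp only [map_add, vdeg_single]
  have := d.2
  have := b.2
  have hab' : a.val < b.val := hab
  have hcd' : c.val < d.val := hcd
  rcases h with h | h | h | h
  · refine ⟨⟨(a, c), by simp only [Fin.lt_def]; omega⟩,
      ⟨(b, d), by simp only [Fin.lt_def]; omega⟩, by abel, ?_⟩
    simp only [edgeClass]; omega
  · refine ⟨⟨(c, a), by simp only [Fin.lt_def]; omega⟩,
      ⟨(d, b), by simp only [Fin.lt_def]; omega⟩, by abel, ?_⟩
    simp only [edgeClass]; omega
  · refine ⟨⟨(a, d), by simp only [Fin.lt_def]; omega⟩,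
      ⟨(c, b), by simp only [Fin.lt_def]; omega⟩, by abel, ?_⟩
    simp only [edgeClass]; omega
  · refine ⟨⟨(c, b), by simp only [Fin.lt_def]; omega⟩,
      ⟨(a, d), by simp only [Fin.lt_def]; omega⟩, by abel, ?_⟩
    simp only [edgeClass]; omega

lemma exists_lt_of_not_std {n : ℕ} {m : MonomialOrder (Edge n)} (hm : IsCircular m)
    {u : Edge n →₀ ℕ} (hu : ¬ Std u) : ∃ v, vdeg v = vdeg u ∧ v ≺[m] u := by
  classical
  simp only [Std, not_forall, not_not] at hu
  obtain ⟨e, f, he, hf, hs⟩ := hu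
  obtain ⟨e', f', hd, h1, h2⟩ := exists_crossing hs
  have hef : e ≠ f := by rintro rfl; exact Sep.irrefl _ hs
  have hle : Finsupp.single e 1 + Finsupp.single f 1 ≤ u := by
    intro s
    by_cases h1 : e = s
    · subst h1; simp [hef.symm]; omega
    · by_cases h2 : f = s
      · subst h2; simp [hef]; omega
      · simp [h1, h2]
  obtain ⟨r, rfl⟩ := exists_add_of_le hle
  refine ⟨Finsupp.single e' 1 + Finsupp.single f' 1 + r, by rw [map_add, hd, ← map_add], ?_⟩
  rw [map_add m.toSyn (_ + _) r, map_add m.toSyn (_ + _) r]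
  exact add_lt_add_left (hm.crossing_lt h1 h2) _

/-- A multigraph with pairwise touching or crossing edges is the smallest one with its degrees. -/
lemma Std.le_of_vdeg_eq {n : ℕ} {m : MonomialOrder (Edge n)} (hm : IsCircular m)
    {a : Edge n →₀ ℕ} (ha : Std a) (c : Edge n →₀ ℕ) (h : vdeg c = vdeg a) : a ≼[m] c := by
  -- Well-founded induction in the term order: a nonstandard exponent has a smaller one in its
  -- fibre, and the only standard one there is `a`.
  have key : ∀ x : m.syn, vdeg (m.toSyn.symm x) = vdeg a → m.toSyn a ≤ x := by
    intro x
    induction x using WellFoundedLT.induction with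
    | _ x ih =>
      intro hx
      by_cases hs : Std (m.toSyn.symm x)
      · rw [ha.eq_of_vdeg_eq hs hx.symm]; simp
      · obtain ⟨v, hv, hlt⟩ := exists_lt_of_not_std hm hs
        simp only [AddEquiv.apply_symm_apply] at hlt
        exact (ih (m.toSyn v) hlt (by simpa using hv.trans hx)).trans hlt.le
  simpa using key (m.toSyn c) (by simpa using h)

lemma toricMap_monomial {n : ℕ} (u : Edge n →₀ ℕ) (c : ℂ) :
    toricMap n (monomial u c) = monomial (vdeg u) c := by
  induction u using Finsupp.induction_linear generalizing c with
  | zero => simp [toricMap, algebraMap_eq]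
  | add f g hf hg =>
    rw [← mul_one c, ← monomial_mul, map_mul, hf, hg, monomial_mul, map_add]
  | single e k =>
    rw [toricMap, aeval_monomial, vdeg_single, ← mul_one c, ← monomial_mul]
    simp [Finsupp.prod_single_index, X_pow_eq_monomial, mul_pow, monomial_mul, algebraMap_eq,
      C_mul_monomial]

/-! ### Substituting a sum of two copies of the variables -/

section SumOfCopies

variable {σ K : Type*} [Field K]

/-- The exponent of `y_0 ^ a * y_1 ^ b` in two copies of the variables. -/
def pairExp (a b : σ →₀ ℕ) : Fin 2 × σ →₀ ℕ :=
  a.mapDomain (Prod.mk 0) + b.mapDomain (Prod.mk 1)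

lemma pairExp_zero_apply (a b : σ →₀ ℕ) (s : σ) : pairExp a b (0, s) = a s := by
  rw [pairExp, Finsupp.add_apply, Finsupp.mapDomain_apply (Prod.mk_right_injective _),
    Finsupp.mapDomain_of_notMem_range _ _ (by simp), add_zero]

lemma pairExp_one_apply (a b : σ →₀ ℕ) (s : σ) : pairExp a b (1, s) = b s := by
  rw [pairExp, Finsupp.add_apply, Finsupp.mapDomain_apply (Prod.mk_right_injective _),
    Finsupp.mapDomain_of_notMem_range _ _ (by simp), zero_add]

lemma pairExp_inj {a b c d : σ →₀ ℕ} : pairExp a b = pairExp c d ↔ a = c ∧ b = d := by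
  refine ⟨fun h => ⟨?_, ?_⟩, by rintro ⟨rfl, rfl⟩; rfl⟩
  · ext s
    simpa only [pairExp_zero_apply] using DFunLike.congr_fun h (0, s)
  · ext s
    simpa only [pairExp_one_apply] using DFunLike.congr_fun h (1, s)

lemma exists_eq_pairExp (v : Fin 2 × σ →₀ ℕ) : ∃ a b, v = pairExp a b := by
  refine ⟨v.comapDomain (Prod.mk 0) (Prod.mk_right_injective _).injOn,
    v.comapDomain (Prod.mk 1) (Prod.mk_right_injective _).injOn, ?_⟩
  ext ⟨i, s⟩
  fin_cases i
  · simp [pairExp_zero_apply]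
  · simp [pairExp_one_apply]

lemma monomial_pairExp (a b : σ →₀ ℕ) (c : K) :
    monomial (pairExp a b) c =
      C c * rename (Prod.mk (0 : Fin 2)) (monomial a 1) * rename (Prod.mk 1) (monomial b 1) := by
  rw [rename_monomial, rename_monomial, C_mul_monomial, monomial_mul, pairExp]
  simp

/-- The homomorphism `f ↦ f(y_0 + y_1)`. -/
def sumMap : MvPolynomial σ K →ₐ[K] MvPolynomial (Fin 2 × σ) K :=
  aeval fun s => ∑ a : Fin 2, X (a, s)

lemma sumMap_monomial [Fintype σ] [DecidableEq σ] (w : σ →₀ ℕ) (c : K) :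
    sumMap (monomial w c) = ∑ a ∈ Fintype.piFinset fun s => Finset.range (w s + 1),
      monomial (pairExp (Finsupp.equivFunOnFinite.symm a)
        (w - Finsupp.equivFunOnFinite.symm a)) (c * ∏ s, ((w s).choose (a s) : K)) := by
  rw [sumMap, aeval_monomial, Finsupp.prod_fintype _ _ (by simp)]
  simp only [Fin.sum_univ_two, add_pow, algebraMap_eq]
  rw [Finset.prod_univ_sum, Finset.mul_sum]
  refine Finset.sum_congr rfl fun a ha => ?_
  rw [monomial_pairExp, Finset.prod_mul_distrib, Finset.prod_mul_distrib,
    monomial_eq, monomial_eq, Finsupp.prod_fintype _ _ (by simp), Finsupp.prod_fintype _ _ (by simp)]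
  simp [map_prod]
  ring

/-- Distinct splittings `a + b` give distinct monomials, so nothing cancels; in characteristic zero
the binomial factor is nonzero. -/
lemma coeff_sumMap [Fintype σ] (f : MvPolynomial σ K) (a b : σ →₀ ℕ) :
    coeff (pairExp a b) (sumMap f) =
      coeff (a + b) f * ∏ s, (((a + b) s).choose (a s) : K) := by
  classical
  induction f using MvPolynomial.induction_on' with
  | add p q hp hq => simp only [map_add, coeff_add, hp, hq, add_mul]
  | monomial w c =>
    rw [sumMap_monomial, coeff_sum]
    simp only [coeff_monomial, pairExp_inj]
    by_cases hw : w = a + b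
    · subst hw
      rw [Finset.sum_eq_single (a : σ → ℕ)]
      · simp
      · intro a' _ hne
        refine if_neg fun h => hne ?_
        rw [← h.1]; rfl
      · intro hn
        exact absurd (Fintype.mem_piFinset.2 fun s => by simp) hn
    · rw [if_neg hw, zero_mul]
      refine Finset.sum_eq_zero fun a' ha' => if_neg fun h => hw ?_
      rw [← h.1, ← h.2, add_tsub_cancel_of_le]
      intro s
      have := Fintype.mem_piFinset.1 ha' s
      simp at this ⊢
      omega

lemma prod_choose_ne_zero [Fintype σ] [CharZero K] (a b : σ →₀ ℕ) :
    ∏ s, (((a + b) s).choose (a s) : K) ≠ 0 :=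
  Finset.prod_ne_zero_iff.2 fun s _ => Nat.cast_ne_zero.2 (Nat.choose_pos (by simp)).ne'

/-- The sum of the two copies of an ideal. -/
def copies (I : Ideal (MvPolynomial σ K)) : Ideal (MvPolynomial (Fin 2 × σ) K) :=
  ⨆ a : Fin 2, I.map (rename (fun s : σ => (a, s)) : MvPolynomial σ K →ₐ[K] _)

lemma mem_secantIdeal_two {I : Ideal (MvPolynomial σ K)} {f : MvPolynomial σ K} :
    f ∈ secantIdeal 2 I ↔ sumMap f ∈ copies I := Iff.rfl

lemma rename_mem_copies {I : Ideal (MvPolynomial σ K)} {f : MvPolynomial σ K} (hf : f ∈ I)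
    (a : Fin 2) : rename (Prod.mk a) f ∈ copies I :=
  Ideal.mem_iSup_of_mem a (Ideal.mem_map_of_mem _ hf)

lemma copies_le {I : Ideal (MvPolynomial σ K)} {J : Ideal (MvPolynomial (Fin 2 × σ) K)}
    (h : ∀ a : Fin 2, ∀ f ∈ I, rename (Prod.mk a) f ∈ J) : copies I ≤ J :=
  iSup_le fun a => Ideal.map_le_iff_le_comap.2 fun f hf => h a f hf

lemma monomial_mem_secantIdeal_two [Fintype σ] {I : Ideal (MvPolynomial σ K)} {u : σ →₀ ℕ}
    (h : ∀ a b, a + b = u → monomial a 1 ∈ I ∨ monomial b 1 ∈ I) (c : K) :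
    monomial u c ∈ secantIdeal 2 I := by
  classical
  rw [mem_secantIdeal_two, (sumMap (monomial u c)).as_sum]
  refine Ideal.sum_mem _ fun v hv => ?_
  obtain ⟨a, b, rfl⟩ := exists_eq_pairExp v
  rw [mem_support_iff, coeff_sumMap, coeff_monomial] at hv
  have hu : u = a + b := by by_contra hu; simp [hu] at hv
  rw [monomial_pairExp]
  rcases h a b hu.symm with h | h
  · exact Ideal.mul_mem_right _ _ (Ideal.mul_mem_left _ _ (rename_mem_copies h 0))
  · exact Ideal.mul_mem_left _ _ (rename_mem_copies h 1)

end SumOfCopies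

/-! ### Kernels of monomial maps -/

section MonomialMap

variable {τ ρ K : Type*} [Field K]

lemma coeff_monomialMap [DecidableEq ρ] {φ : MvPolynomial τ K →ₐ[K] MvPolynomial ρ K}
    {D : (τ →₀ ℕ) → (ρ →₀ ℕ)} (hφ : ∀ v c, φ (monomial v c) = monomial (D v) c)
    (g : MvPolynomial τ K) (d : ρ →₀ ℕ) :
    coeff d (φ g) = ∑ v ∈ g.support with D v = d, coeff v g := by
  conv_lhs => rw [g.as_sum]
  rw [map_sum, coeff_sum, Finset.sum_filter]
  simp only [hφ, coeff_monomial]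

/-- The kernel of a monomial map is generated by binomials. -/
lemma mem_of_monomialMap_eq_zero {φ : MvPolynomial τ K →ₐ[K] MvPolynomial ρ K}
    {D : (τ →₀ ℕ) → (ρ →₀ ℕ)} (hφ : ∀ v c, φ (monomial v c) = monomial (D v) c)
    {J : Ideal (MvPolynomial τ K)}
    (hJ : ∀ v w, D v = D w → monomial v 1 - monomial w 1 ∈ J)
    {g : MvPolynomial τ K} (hg : φ g = 0) : g ∈ J := by
  classical
  rw [← Ideal.Quotient.eq_zero_iff_mem, g.as_sum, map_sum,
    ← Finset.sum_fiberwise_of_maps_to (t := g.support.image D)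
      fun v hv => Finset.mem_image_of_mem D hv]
  refine Finset.sum_eq_zero fun d hd => ?_
  obtain ⟨w, hw, rfl⟩ := Finset.mem_image.1 hd
  have h1 : ∀ v ∈ g.support.filter (fun v => D v = D w),
      Ideal.Quotient.mk J (monomial v (coeff v g)) =
        Ideal.Quotient.mk J (C (coeff v g)) * Ideal.Quotient.mk J (monomial w 1) := by
    intro v hv
    rw [← Ideal.Quotient.eq.2 (hJ v w (Finset.mem_filter.1 hv).2), ← map_mul, C_mul_monomial,
      mul_one]
  rw [Finset.sum_congr rfl h1, ← Finset.sum_mul, ← map_sum, ← map_sum,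
    ← coeff_monomialMap hφ, hg]
  simp

end MonomialMap

/-! ### Initial ideals of the toric ideal and of its secant ideal -/

section Toric

variable {n : ℕ}

/-- Two copies of the toric map. -/
def toricMapTwo (n : ℕ) :
    MvPolynomial (Fin 2 × Edge n) ℂ →ₐ[ℂ] MvPolynomial (Fin 2 × Fin n) ℂ :=
  aeval fun p => X (p.1, p.2.1.1) * X (p.1, p.2.1.2)

lemma toricMapTwo_rename (a : Fin 2) (f : MvPolynomial (Edge n) ℂ) :
    toricMapTwo n (rename (Prod.mk a) f) = rename (Prod.mk a) (toricMap n f) := by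
  have : (toricMapTwo n).comp (rename (Prod.mk a)) = (rename (Prod.mk a)).comp (toricMap n) := by
    ext e
    simp [toricMapTwo, toricMap]
  exact DFunLike.congr_fun this f

lemma toricMapTwo_monomial (a b : Edge n →₀ ℕ) (c : ℂ) :
    toricMapTwo n (monomial (pairExp a b) c) = monomial (pairExp (vdeg a) (vdeg b)) c := by
  rw [monomial_pairExp, map_mul, map_mul, toricMapTwo_rename, toricMapTwo_rename,
    toricMap_monomial, toricMap_monomial, monomial_pairExp, toricMapTwo, aeval_C, algebraMap_eq]

/-- The degree sequences of two multigraphs. -/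
def vdegTwo (v : Fin 2 × Edge n →₀ ℕ) : Fin 2 × Fin n →₀ ℕ :=
  pairExp (vdeg (exists_eq_pairExp v).choose) (vdeg (exists_eq_pairExp v).choose_spec.choose)

lemma vdegTwo_pairExp (a b : Edge n →₀ ℕ) :
    vdegTwo (pairExp a b) = pairExp (vdeg a) (vdeg b) := by
  have h := (exists_eq_pairExp (pairExp a b)).choose_spec.choose_spec
  rw [pairExp_inj] at h
  rw [vdegTwo, pairExp_inj]
  exact ⟨congrArg vdeg h.1.symm, congrArg vdeg h.2.symm⟩

lemma toricMapTwo_monomial' (v : Fin 2 × Edge n →₀ ℕ) (c : ℂ) :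
    toricMapTwo n (monomial v c) = monomial (vdegTwo v) c := by
  obtain ⟨a, b, rfl⟩ := exists_eq_pairExp v
  rw [toricMapTwo_monomial, vdegTwo_pairExp]

lemma sub_mem_toricIdeal {a b : Edge n →₀ ℕ} (h : vdeg a = vdeg b) :
    monomial a 1 - monomial b 1 ∈ toricIdeal n := by
  rw [toricIdeal, RingHom.mem_ker, map_sub, toricMap_monomial, toricMap_monomial, h, sub_self]

/-- The kernel is generated by binomials, and a binomial of pairs is handled by changing the
exponent of one copy at a time. -/
lemma mem_copies_toricIdeal {g : MvPolynomial (Fin 2 × Edge n) ℂ} :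
    g ∈ copies (toricIdeal n) ↔ toricMapTwo n g = 0 := by
  constructor
  · intro h
    rw [← RingHom.mem_ker]
    refine copies_le (fun a f hf => ?_) h
    rw [RingHom.mem_ker, toricMapTwo_rename, (RingHom.mem_ker).1 hf, map_zero]
  · refine mem_of_monomialMap_eq_zero toricMapTwo_monomial' fun v w h => ?_
    obtain ⟨a, b, rfl⟩ := exists_eq_pairExp v
    obtain ⟨c, d, rfl⟩ := exists_eq_pairExp w
    rw [vdegTwo_pairExp, vdegTwo_pairExp, pairExp_inj] at h
    have : (monomial (pairExp a b) 1 - monomial (pairExp c d) 1 :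
        MvPolynomial (Fin 2 × Edge n) ℂ) =
        rename (Prod.mk 0) (monomial a 1 - monomial c 1) * rename (Prod.mk 1) (monomial b 1) +
        rename (Prod.mk 0) (monomial c 1) * rename (Prod.mk 1) (monomial b 1 - monomial d 1) := by
      rw [monomial_pairExp, monomial_pairExp, map_sub, map_sub, C_1]
      ring
    rw [this]
    exact add_mem (Ideal.mul_mem_right _ _ (rename_mem_copies (sub_mem_toricIdeal h.1) 0))
      (Ideal.mul_mem_left _ _ (rename_mem_copies (sub_mem_toricIdeal h.2) 1))

/-- Parametric form of the secant variety: off-diagonal entries of symmetric matrices of rank at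
most two. -/
lemma mem_secantIdeal_toricIdeal {f : MvPolynomial (Edge n) ℂ} :
    f ∈ secantIdeal 2 (toricIdeal n) ↔
      aeval (fun e : Edge n => (∑ a : Fin 2, X (a, e.1.1) * X (a, e.1.2) :
        MvPolynomial (Fin 2 × Fin n) ℂ)) f = 0 := by
  rw [mem_secantIdeal_two, mem_copies_toricIdeal, ← AlgHom.comp_apply]
  have : (toricMapTwo n).comp sumMap = aeval (fun e : Edge n =>
      (∑ a : Fin 2, X (a, e.1.1) * X (a, e.1.2) : MvPolynomial (Fin 2 × Fin n) ℂ)) := by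
    ext e : 1
    simp [sumMap, toricMapTwo]
  rw [this]

variable {m : MonomialOrder (Edge n)}

/-- A standard leading exponent would be the smallest in its fibre, hence the only exponent of `f`
there, and its coefficient would survive under the toric map. -/
lemma not_std_degree (hm : IsCircular m) {f : MvPolynomial (Edge n) ℂ} (hf : f ∈ toricIdeal n)
    (h0 : f ≠ 0) : ¬ Std (m.degree f) := by
  classical
  intro hs
  have h1 := coeff_monomialMap toricMap_monomial f (vdeg (m.degree f))
  rw [(RingHom.mem_ker).1 hf, coeff_zero, Finset.sum_eq_single (m.degree f)] at h1
  · exact h0 (MonomialOrder.coeff_degree_eq_zero_iff.1 h1.symm)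
  · intro v hv hne
    rw [Finset.mem_filter] at hv
    exact absurd (m.toSyn.injective
      ((m.le_degree hv.1).antisymm (hs.le_of_vdeg_eq hm v hv.2))) hne
  · intro hn
    simp [h0] at hn

lemma monomial_mem_initialIdeal (hm : IsCircular m) {u : Edge n →₀ ℕ} (hu : ¬ Std u) :
    monomial u 1 ∈ initialIdeal m (toricIdeal n) := by
  obtain ⟨v, hv, hlt⟩ := exists_lt_of_not_std hm hu
  have h2 : m.degree (monomial v (1 : ℂ)) ≺[m] m.degree (monomial u (1 : ℂ)) := by
    classical simpa [m.degree_monomial] using hlt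
  have h3 : m.leadingTerm (monomial u (1 : ℂ) - monomial v 1) = monomial u 1 := by
    classical
    rw [MonomialOrder.leadingTerm, m.leadingCoeff_sub_of_lt h2, m.degree_sub_of_lt h2,
      m.leadingCoeff_monomial, m.degree_monomial, if_neg one_ne_zero]
  rw [← h3]
  exact Ideal.subset_span ⟨_, sub_mem_toricIdeal hv.symm, rfl⟩

lemma initialIdeal_toricIdeal_le (hm : IsCircular m) :
    initialIdeal m (toricIdeal n) ≤
      Ideal.span ((fun u => monomial u (1 : ℂ)) '' {u | ¬ Std u}) := by
  refine Ideal.span_le.2 ?_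
  rintro _ ⟨f, hf, rfl⟩
  rw [SetLike.mem_coe, mem_ideal_span_monomial_image]
  intro v hv
  have h0 : f ≠ 0 := by rintro rfl; simp at hv
  rw [m.support_leadingTerm' h0, Finset.mem_singleton] at hv
  exact ⟨v, hv ▸ not_std_degree hm hf h0, le_rfl⟩

lemma Std.mono {u v : Edge n →₀ ℕ} (hv : Std v) (h : u ≤ v) : Std u := fun e f he hf =>
  hv e f (by have := h e; omega) (by have := h f; omega)

lemma not_std_of_mem_secantIdeal_initialIdeal (hm : IsCircular m) {f : MvPolynomial (Edge n) ℂ}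
    (hf : f ∈ secantIdeal 2 (initialIdeal m (toricIdeal n))) {a b : Edge n →₀ ℕ}
    (hab : coeff (a + b) f ≠ 0) (ha : Std a) (hb : Std b) : False := by
  have h1 : copies (initialIdeal m (toricIdeal n)) ≤ Ideal.span
      ((fun u => monomial u (1 : ℂ)) ''
        {v | ∃ a b : Edge n →₀ ℕ, v = pairExp a b ∧ (¬ Std a ∨ ¬ Std b)}) := by
    refine copies_le fun i f hf => ?_
    replace hf := Ideal.mem_map_of_mem (rename (Prod.mk i)) (initialIdeal_toricIdeal_le hm hf)
    rw [Ideal.map_span] at hf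
    refine Ideal.span_mono ?_ hf
    rintro _ ⟨_, ⟨u, hu, rfl⟩, rfl⟩
    fin_cases i
    · exact ⟨pairExp u 0, ⟨u, 0, rfl, Or.inl hu⟩, by simp [pairExp, rename_monomial]⟩
    · exact ⟨pairExp 0 u, ⟨0, u, rfl, Or.inr hu⟩, by simp [pairExp, rename_monomial]⟩
  have h2 := mem_ideal_span_monomial_image.1 (h1 (mem_secantIdeal_two.1 hf)) (pairExp a b)
    (by rw [mem_support_iff, coeff_sumMap]; exact mul_ne_zero hab (prod_choose_ne_zero a b))
  obtain ⟨_, ⟨c, d, rfl, hcd⟩, hle⟩ := h2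
  rcases hcd with h | h
  · refine h (ha.mono fun s => ?_)
    simpa only [pairExp_zero_apply] using hle (0, s)
  · refine h (hb.mono fun s => ?_)
    simpa only [pairExp_one_apply] using hle (1, s)

/-- Consider the coefficient at the degrees of `(a, b)` in the image of `f`. A contributing pair
`(c, d)` satisfies `a ≼ c` and `b ≼ d` by minimality, but `c + d ≼ a + b` since `a + b` is leading.
So only `(a, b)` contributes, and the coefficient is nonzero. -/
lemma not_std_of_mem_secantIdeal (hm : IsCircular m) {f : MvPolynomial (Edge n) ℂ}
    (hf : f ∈ secantIdeal 2 (toricIdeal n)) (h0 : f ≠ 0) {a b : Edge n →₀ ℕ}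
    (hab : a + b = m.degree f) (ha : Std a) (hb : Std b) : False := by
  classical
  have h1 := coeff_monomialMap toricMapTwo_monomial' (sumMap f) (pairExp (vdeg a) (vdeg b))
  rw [mem_copies_toricIdeal.1 (mem_secantIdeal_two.1 hf), coeff_zero,
    Finset.sum_eq_single (pairExp a b)] at h1
  · rw [coeff_sumMap, hab] at h1
    refine mul_ne_zero ?_ (hab ▸ prod_choose_ne_zero a b) h1.symm
    exact MonomialOrder.coeff_degree_ne_zero_iff.2 h0
  · intro v hv hne
    obtain ⟨c, d, rfl⟩ := exists_eq_pairExp v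
    rw [Finset.mem_filter, mem_support_iff, coeff_sumMap, vdegTwo_pairExp, pairExp_inj] at hv
    obtain ⟨hv, hc, hd⟩ := hv
    have h2 := ha.le_of_vdeg_eq hm c hc
    have h3 := hb.le_of_vdeg_eq hm d hd
    have h4 := m.le_degree (mem_support_iff.2 (left_ne_zero_of_mul hv))
    rw [← hab, map_add, map_add] at h4
    have h5 : m.toSyn c = m.toSyn a :=
      le_antisymm (le_of_add_le_add_right (h4.trans (add_le_add_right h3 _))) h2
    have h6 : m.toSyn d = m.toSyn b :=
      le_antisymm (le_of_add_le_add_left (h4.trans (add_le_add_left h2 _))) h3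
    exact absurd (pairExp_inj.2 ⟨m.toSyn.injective h5, m.toSyn.injective h6⟩) hne
  · intro hn
    simpa [mem_support_iff, vdegTwo_pairExp] using hn

/-- The inclusions `in(I^{2}) ⊆ in(I)^{2} ⊆ ⟨in(G)⟩ ⊆ in(I^{2})` close up; `hlead` is the
combinatorial input for the middle one. -/
lemma isDelightful_and_isGroebnerBasis (hm : IsCircular m) {G : Set (MvPolynomial (Edge n) ℂ)}
    (hfin : G.Finite) (hG : G ⊆ (secantIdeal 2 (toricIdeal n) : Set (MvPolynomial (Edge n) ℂ)))
    (hlead : ∀ u : Edge n →₀ ℕ, (∀ a b, a + b = u → Std a → Std b → False) →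
      ∃ g ∈ G, g ≠ 0 ∧ m.degree g ≤ u) :
    IsDelightful m 2 (toricIdeal n) ∧ IsGroebnerBasis m G (secantIdeal 2 (toricIdeal n)) := by
  have h1 : initialIdeal m (secantIdeal 2 (toricIdeal n)) ≤
      secantIdeal 2 (initialIdeal m (toricIdeal n)) := by
    refine Ideal.span_le.2 ?_
    rintro _ ⟨f, hf, rfl⟩
    by_cases h0 : f = 0
    · simp [h0]
    refine monomial_mem_secantIdeal_two (fun a b hab => ?_) _
    by_contra! hcon
    exact not_std_of_mem_secantIdeal hm hf h0 hab
      (not_not.1 fun h => hcon.1 (monomial_mem_initialIdeal hm h))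
      (not_not.1 fun h => hcon.2 (monomial_mem_initialIdeal hm h))
  have h2 : secantIdeal 2 (initialIdeal m (toricIdeal n)) ≤
      Ideal.span (m.leadingTerm '' G) := by
    intro f hf
    rw [f.as_sum]
    refine Ideal.sum_mem _ fun u hu => ?_
    obtain ⟨g, hg, hg0, hgu⟩ := hlead u fun a b hab ha hb =>
      not_std_of_mem_secantIdeal_initialIdeal hm hf (hab ▸ mem_support_iff.1 hu) ha hb
    refine Ideal.mem_of_dvd _ ?_ (Ideal.subset_span ⟨g, hg, rfl⟩)
    rw [MonomialOrder.leadingTerm, monomial_dvd_monomial]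
    exact ⟨Or.inr hgu, (IsUnit.mk0 _ (m.leadingCoeff_ne_zero_iff.2 hg0)).dvd⟩
  have h3 : Ideal.span (m.leadingTerm '' G) ≤ initialIdeal m (secantIdeal 2 (toricIdeal n)) :=
    Ideal.span_mono (Set.image_mono hG)
  exact ⟨h1.antisymm (h2.trans h3), hfin, hG, h3.antisymm (h1.trans h2)⟩

end Toric

/-! ### Membership of the listed polynomials in the secant ideal -/

section Vanishing

/-- Otherwise `c l + c (e l) = 1` for all `l`, and summing over `l` makes the odd cardinality equal
to twice the sum of `c`. -/
lemma exists_eq_comp_of_odd_card {ι : Type*} [Fintype ι] (h : Odd (Fintype.card ι))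
    (e : Equiv.Perm ι) (c : ι → Fin 2) : ∃ l, c l = c (e l) := by
  by_contra! hcon
  have h1 : ∀ l, (c l).val + (c (e l)).val = 1 := by
    intro l
    have := hcon l
    rw [Ne, Fin.ext_iff] at this
    omega
  have h2 : ∑ l, ((c l).val + (c (e l)).val) = Fintype.card ι := by simp [h1]
  rw [Finset.sum_add_distrib, Equiv.sum_comp e fun l => (c l).val] at h2
  obtain ⟨k, hk⟩ := h
  omega

lemma sum_neg_one_pow_card_mul_prod_eq_zero {ι R : Type*} [Fintype ι] [DecidableEq ι] [CommRing R]
    (f g : ι → R) (h : ∃ l, f l = g l) :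
    ∑ S : Finset ι, (-1) ^ S.card * ∏ l, (if l ∈ S then f l else g l) = 0 := by
  have h1 : ∏ l, (-f l + g l) = 0 := by
    obtain ⟨l, hl⟩ := h
    exact Finset.prod_eq_zero (Finset.mem_univ l) (by rw [hl]; ring)
  rw [← h1, Finset.prod_add, Finset.powerset_univ]
  refine Finset.sum_congr rfl fun S _ => ?_
  rw [Finset.prod_ite, Finset.prod_neg]
  simp [Finset.filter_not, mul_assoc]

/-- A closed chain of odd length of antisymmetric forms on a plane contracts to zero. -/
lemma sum_neg_one_pow_card_mul_prod_pairing_eq_zero {ι R : Type*} [Fintype ι] [DecidableEq ι]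
    [CommRing R] (hodd : Odd (Fintype.card ι)) (e : Equiv.Perm ι) (p q : ι → Fin 2 → R) :
    ∑ S : Finset ι, (-1) ^ S.card * ∏ l, ∑ c, (if l ∈ S then q l else p l) c *
      (if e l ∈ S then p (e l) else q (e l)) c = 0 := by
  simp only [Finset.prod_univ_sum, Finset.mul_sum]
  rw [Finset.sum_comm]
  refine Finset.sum_eq_zero fun c _ => ?_
  -- For fixed coordinates `c` the factors are regrouped by transposition instead of by edge: `p l`
  -- and `q l` occur with the coordinates `c l` and `c (e.symm l)`. The alternating sum becomes a
  -- product of 2 × 2 determinants, one of which has equal coordinates.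
  rw [← sum_neg_one_pow_card_mul_prod_eq_zero (fun l => q l (c l) * p l (c (e.symm l)))
    (fun l => p l (c l) * q l (c (e.symm l)))]
  · refine Finset.sum_congr rfl fun S _ => ?_
    have h1 : ∏ l, (if e l ∈ S then p (e l) else q (e l)) (c l) =
        ∏ l, (if l ∈ S then p l else q l) (c (e.symm l)) := by
      rw [← Equiv.prod_comp e fun l => (if l ∈ S then p l else q l) (c (e.symm l))]
      simp
    rw [Finset.prod_mul_distrib, h1, ← Finset.prod_mul_distrib]
    congr 1
    refine Finset.prod_congr rfl fun l _ => ?_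
    split_ifs <;> rfl
  · obtain ⟨l, hl⟩ := exists_eq_comp_of_odd_card hodd e.symm c
    exact ⟨l, by rw [hl]; ring⟩

variable {n : ℕ}

/-- The edge joining two vertices. -/
def mkEdge (a b : Fin n) (h : a ≠ b) : Edge n :=
  if h' : a < b then ⟨(a, b), h'⟩ else ⟨(b, a), lt_of_le_of_ne (not_lt.1 h') h.symm⟩

lemma x_eq_X (a b : Fin n) (h : a ≠ b) : x a b = X (mkEdge a b h) := by
  unfold x mkEdge
  split_ifs with h1 h2
  · rfl
  · rfl
  · exact absurd (le_antisymm (not_lt.1 h2) (not_lt.1 h1)) h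

lemma mkEdge_eq_iff {a b c d : Fin n} {h : a ≠ b} {h' : c ≠ d} :
    mkEdge a b h = mkEdge c d h' ↔ (a = c ∧ b = d) ∨ (a = d ∧ b = c) := by
  unfold mkEdge
  split_ifs <;> simp only [Subtype.mk.injEq, Prod.mk.injEq] <;> grind

lemma edgeClass_mkEdge (a b : Fin n) (h : a ≠ b) :
    edgeClass (mkEdge a b h) = min (b - a).val (n - (b - a).val) := by
  unfold mkEdge edgeClass
  have h' : a.val ≠ b.val := fun h' => h (Fin.ext h')
  rw [Fin.sub_def]
  split_ifs with h1
  · rw [Fin.lt_def] at h1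
    simp only
    rw [show n - a.val + b.val = (b.val - a.val) + n by omega, Nat.add_mod_right,
      Nat.mod_eq_of_lt (by omega)]
  · rw [Fin.lt_def] at h1
    simp only
    rw [Nat.mod_eq_of_lt (by omega)]
    omega

lemma aeval_x (a b : Fin n) (h : a ≠ b) :
    aeval (fun e : Edge n => (∑ c : Fin 2, X (c, e.1.1) * X (c, e.1.2) :
        MvPolynomial (Fin 2 × Fin n) ℂ)) (x a b) = ∑ c : Fin 2, X (c, a) * X (c, b) := by
  rw [x_eq_X a b h, aeval_X]
  unfold mkEdge
  split_ifs
  · rfl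
  · simp only [mul_comm]

lemma det_mem_secantIdeal {a b : Fin 3 → Fin n} (h : ∀ s t, a s ≠ b t) :
    (Matrix.of fun s t => x (a s) (b t)).det ∈ secantIdeal 2 (toricIdeal n) := by
  rw [mem_secantIdeal_toricIdeal, AlgHom.map_det, Matrix.det_fin_three]
  simp only [AlgHom.mapMatrix_apply, Matrix.map_apply, Matrix.of_apply]
  simp only [aeval_x _ _ (h _ _)]
  simp only [Fin.sum_univ_two]
  ring

/-- The permutation `l ↦ l + k` of the indices. -/
def shiftEquiv (k : ℕ) : Equiv.Perm (Fin (2 * k + 1)) := Equiv.addRight (Fin.ofNat (2 * k + 1) k)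

/-- The left end of the `l`-th edge of the term of a master polynomial indexed by `S`. -/
def leftEnd {k : ℕ} (i j : Fin (2 * k + 1) → Fin n) (S : Finset (Fin (2 * k + 1)))
    (l : Fin (2 * k + 1)) : Fin n := if l ∈ S then j (l - 1) else i l

/-- The right end of the `l`-th edge of the term of a master polynomial indexed by `S`. -/
def rightEnd {k : ℕ} (i j : Fin (2 * k + 1) → Fin n) (S : Finset (Fin (2 * k + 1)))
    (l : Fin (2 * k + 1)) : Fin n :=
  if shift k l ∈ S then i (shift k l) else j (shift k l - 1)

lemma masterPolynomial_mem_secantIdeal {k : ℕ} {i j : Fin (2 * k + 1) → Fin n}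
    (h : ∀ S l, leftEnd i j S l ≠ rightEnd i j S l) :
    masterPolynomial k i j ∈ secantIdeal 2 (toricIdeal n) := by
  rw [mem_secantIdeal_toricIdeal, masterPolynomial, map_sum]
  have h1 := sum_neg_one_pow_card_mul_prod_pairing_eq_zero
    (R := MvPolynomial (Fin 2 × Fin n) ℂ) (ι := Fin (2 * k + 1)) (by simp) (shiftEquiv k)
    (fun l c => X (c, i l)) (fun l c => X (c, j (l - 1)))
  rw [← h1]
  refine Finset.sum_congr rfl fun S _ => ?_
  rw [map_mul, map_pow, map_neg, map_one, map_prod]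
  congr 1
  refine Finset.prod_congr rfl fun l _ => ?_
  have h2 := aeval_x _ _ (h S l)
  unfold leftEnd rightEnd at h2
  rw [h2]
  refine Finset.sum_congr rfl fun c _ => ?_
  have h3 : shiftEquiv k l = shift k l := rfl
  rw [h3]
  congr 1 <;> split_ifs <;> rfl

end Vanishing

/-! ### Recognizing leading terms in block orders -/

section LeadingTerm

/-- A sufficient condition for `u` to precede `v` in all block orders. -/
def BlockLT {σ : Type*} (blk : σ → ℕ) (u v : σ →₀ ℕ) : Prop :=
  ∃ c : ℕ, (∀ s, blk s < c → u s = v s) ∧ (∀ s, blk s = c → u s ≤ v s) ∧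
    ∃ s, blk s = c ∧ u s < v s

lemma BlockLT.ne {σ : Type*} {blk : σ → ℕ} {u v : σ →₀ ℕ} (h : BlockLT blk u v) : u ≠ v := by
  rintro rfl
  obtain ⟨c, -, -, s, -, hs⟩ := h
  exact lt_irrefl _ hs

lemma BlockLT.lt {σ : Type*} {blk : σ → ℕ} {u v : σ →₀ ℕ} (h : BlockLT blk u v)
    {m : MonomialOrder σ} (hm : IsBlockOrder m blk) : u ≺[m] v := by
  obtain ⟨c, h1, h2, h3⟩ := h
  exact hm.lt c h1 h2 h3

/-- Among the changed factors take one whose old block is smallest. By hypothesis all new factors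
lie in strictly later blocks, so in that block and before it factors are only lost. -/
lemma blockLT_sum_single {σ ι : Type*} [Fintype ι] {blk : σ → ℕ} {e' e : ι → σ}
    (h : ∀ l, e' l ≠ e l → ∃ l', e' l' ≠ e l' ∧ blk (e l') < blk (e' l)) (hne : ∃ l, e' l ≠ e l) :
    BlockLT blk (∑ l, Finsupp.single (e' l) 1) (∑ l, Finsupp.single (e l) 1) := by
  classical
  obtain ⟨l0, hl0, hmin⟩ := Finset.exists_min_image
    (Finset.univ.filter fun l => e' l ≠ e l) (fun l => blk (e l))
    (by obtain ⟨l, hl⟩ := hne; exact ⟨l, by simpa using hl⟩)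
  simp only [Finset.mem_filter, Finset.mem_univ, true_and] at hl0 hmin
  have hbig : ∀ l, e' l ≠ e l → blk (e l0) < blk (e' l) := by
    intro l hl
    obtain ⟨l', hl', hlt⟩ := h l hl
    exact (hmin l' hl').trans_lt hlt
  have hzero : ∀ l, e' l ≠ e l → ∀ s, blk s ≤ blk (e l0) → e' l ≠ s := by
    rintro l hl s hs rfl
    exact absurd (hbig l hl) (not_lt.2 hs)
  simp only [BlockLT, Finsupp.finsetSum_apply]
  refine ⟨blk (e l0), fun s hs => Finset.sum_congr rfl fun l _ => ?_,
    fun s hs => Finset.sum_le_sum fun l _ => ?_, e l0, rfl,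
    Finset.sum_lt_sum (fun l _ => ?_) ⟨l0, Finset.mem_univ _, ?_⟩⟩
  · by_cases hl : e' l = e l
    · rw [hl]
    · have h1 : e l ≠ s := by
        rintro rfl
        exact absurd (hmin l hl) (not_le.2 hs)
      simp [hzero l hl s hs.le, h1]
  · by_cases hl : e' l = e l
    · rw [hl]
    · simp [hzero l hl s hs.le]
  · by_cases hl : e' l = e l
    · rw [hl]
    · simp [hzero l hl _ le_rfl]
  · simp [hl0]

variable {σ ι K : Type*} [Field K] [Fintype ι]

lemma sum_monomial_ne_zero {f : MvPolynomial σ K} {v : ι → σ →₀ ℕ} {c : ι → K}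
    (hf : f = ∑ i, monomial (v i) (c i)) (i₀ : ι) (hc : c i₀ ≠ 0)
    (hv : ∀ i, i ≠ i₀ → v i ≠ v i₀) : coeff (v i₀) f ≠ 0 := by
  classical
  rw [hf, coeff_sum, Finset.sum_eq_single i₀]
  · simpa using hc
  · intro i _ hi
    rw [coeff_monomial, if_neg (hv i hi)]
  · simp

lemma degree_sum_monomial (m : MonomialOrder σ) {f : MvPolynomial σ K} {v : ι → σ →₀ ℕ}
    {c : ι → K} (hf : f = ∑ i, monomial (v i) (c i)) (i₀ : ι) (hc : c i₀ ≠ 0)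
    (hv : ∀ i, i ≠ i₀ → v i ≺[m] v i₀) : m.degree f = v i₀ := by
  classical
  have h1 : coeff (v i₀) f ≠ 0 :=
    sum_monomial_ne_zero hf i₀ hc fun i hi heq => by simpa [heq] using hv i hi
  refine m.toSyn.injective (le_antisymm (m.degree_le_iff.2 fun b hb => ?_)
    (m.le_degree (mem_support_iff.2 h1)))
  rw [hf] at hb
  obtain ⟨i, -, hi⟩ := Finset.mem_biUnion.1 (support_sum hb)
  rw [Finset.mem_singleton.1 (support_monomial_subset hi)]
  by_cases h : i = i₀
  · rw [h]
  · exact (hv i h).le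

lemma totalDegree_sum_monomial {f : MvPolynomial σ K} {v : ι → σ →₀ ℕ} {c : ι → K}
    (hf : f = ∑ i, monomial (v i) (c i)) (h0 : f ≠ 0) (d : ℕ) (hd : ∀ i, (v i).degree = d) :
    f.totalDegree = d := by
  refine IsHomogeneous.totalDegree ?_ h0
  rw [hf]
  exact IsHomogeneous.sum _ _ _ fun i _ => isHomogeneous_monomial _ (hd i)

end LeadingTerm

variable {n : ℕ}

/-! ### Leading terms of off-diagonal minors -/

section Minors

/-- Off-diagonal minors as sums of monomials, the rows and columns being listed in any order. -/
lemma det_eq_sum_monomial {a b : Fin 3 → Fin n} (h : ∀ s t, a s ≠ b t) :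
    (Matrix.of fun s t => x (a s) (b t)).det = ∑ π : Equiv.Perm (Fin 3),
      monomial (∑ s, Finsupp.single (mkEdge (a (π s)) (b s) (h _ _)) 1)
        (((Equiv.Perm.sign π : ℤ) : ℂ)) := by
  rw [Matrix.det_apply']
  refine Finset.sum_congr rfl fun π _ => ?_
  simp only [Matrix.of_apply, x_eq_X _ _ (h _ _), X]
  rw [← monomial_sum_one, ← map_intCast (C : ℂ →+* MvPolynomial (Edge n) ℂ), C_mul_monomial,
    mul_one]

lemma exists_mem_offDiagonalMinors {a b : Fin 3 → Fin n} (ha : Function.Injective a)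
    (hb : Function.Injective b) (h : ∀ s t, a s ≠ b t) :
    ∃ g ∈ offDiagonalMinors n, ∃ c : ℂ, c ≠ 0 ∧
      g = C c * (Matrix.of fun s t => x (a s) (b t)).det := by
  have hs : ∀ {f : Fin 3 → Fin n}, Function.Injective f → StrictMono (f ∘ Tuple.sort f) :=
    fun {f} hf => (Tuple.monotone_sort f).strictMono_of_injective
      (hf.comp (Tuple.sort f).injective)
  refine ⟨_, ⟨a ∘ Tuple.sort a, b ∘ Tuple.sort b, hs ha, hs hb, fun s t => h _ _, rfl⟩,
    ((Equiv.Perm.sign (Tuple.sort a) : ℤ) : ℂ) * ((Equiv.Perm.sign (Tuple.sort b) : ℤ) : ℂ), ?_, ?_⟩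
  · exact mul_ne_zero (by simp) (by simp)
  · have h1 := Matrix.det_permute (Tuple.sort a)
      ((Matrix.of fun s t => x (a s) (b t)).submatrix id (Tuple.sort b))
    rw [Matrix.det_permute'] at h1
    rw [map_mul, map_intCast, map_intCast, mul_assoc, ← h1]
    rfl

/-- By `hK` every off-diagonal entry has larger class than the diagonal entry of its row or of its
column. A nontrivial permutation replaces both of these, so the diagonal term leads. -/
lemma exists_offDiagonalMinor_degree {m : MonomialOrder (Edge n)} (hm : IsCircular m)
    {a b : Fin 3 → Fin n} (ha : Function.Injective a) (hb : Function.Injective b)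
    (h : ∀ s t, a s ≠ b t)
    (hK : ∀ s t, s ≠ t → min (edgeClass (mkEdge (a s) (b s) (h s s)))
      (edgeClass (mkEdge (a t) (b t) (h t t))) < edgeClass (mkEdge (a s) (b t) (h s t))) :
    ∃ g ∈ offDiagonalMinors n, g ≠ 0 ∧
      m.degree g = ∑ s, Finsupp.single (mkEdge (a s) (b s) (h s s)) 1 := by
  obtain ⟨g, hg, c, hc, rfl⟩ := exists_mem_offDiagonalMinors ha hb h
  have hf : C c * (Matrix.of fun s t => x (a s) (b t)).det = ∑ π : Equiv.Perm (Fin 3),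
      monomial (∑ s, Finsupp.single (mkEdge (a (π s)) (b s) (h _ _)) 1)
        (c * ((Equiv.Perm.sign π : ℤ) : ℂ)) := by
    simp only [det_eq_sum_monomial h, Finset.mul_sum, C_mul_monomial]
  have hlt : ∀ π : Equiv.Perm (Fin 3), π ≠ 1 → BlockLT edgeClass
      (∑ s, Finsupp.single (mkEdge (a (π s)) (b s) (h _ _)) 1)
      (∑ s, Finsupp.single (mkEdge (a s) (b s) (h _ _)) 1) := by
    intro π hπ
    have hiff : ∀ s, mkEdge (a (π s)) (b s) (h _ _) ≠ mkEdge (a s) (b s) (h _ _) ↔ π s ≠ s := by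
      intro s
      rw [Ne, mkEdge_eq_iff, not_iff_not]
      exact ⟨fun h' => h'.elim (fun h' => ha h'.1) fun h' => absurd h'.1 (h _ _),
        fun h' => Or.inl ⟨by rw [h'], rfl⟩⟩
    refine blockLT_sum_single (fun s hs => ?_) ?_
    · rw [hiff] at hs
      rcases min_lt_iff.1 (hK _ _ hs) with h1 | h1
      · exact ⟨π s, (hiff _).2 fun h' => hs (π.injective h'), h1⟩
      · exact ⟨s, (hiff _).2 hs, h1⟩
    · by_contra! hcon
      exact hπ (Equiv.ext fun s => by_contra fun hs => (hiff s).2 hs (hcon s))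
  have hc1 : c * ((Equiv.Perm.sign (1 : Equiv.Perm (Fin 3)) : ℤ) : ℂ) ≠ 0 := by simpa using hc
  refine ⟨_, hg, fun h0 => ?_, ?_⟩
  · have := sum_monomial_ne_zero hf 1 hc1 fun π hπ => (hlt π hπ).ne
    exact this (by rw [h0, coeff_zero])
  · exact degree_sum_monomial m hf 1 hc1 fun π hπ => (hlt π hπ).lt hm

lemma totalDegree_of_mem_offDiagonalMinors {f : MvPolynomial (Edge n) ℂ}
    (hf : f ∈ offDiagonalMinors n) : f.totalDegree = 3 := by
  obtain ⟨a, b, ha, hb, h, rfl⟩ := hf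
  have h1 := sum_monomial_ne_zero (det_eq_sum_monomial h) 1 (by simp) fun π hπ heq => by
    refine hπ (Equiv.ext fun s => ?_)
    have h2 := DFunLike.congr_fun heq (mkEdge (a (π s)) (b s) (h _ _))
    rw [Finsupp.finsetSum_apply, Finsupp.finsetSum_apply] at h2
    have h3 : (∑ t, Finsupp.single (mkEdge (a (π t)) (b t) (h _ _)) 1
        (mkEdge (a (π s)) (b s) (h _ _))) ≠ 0 := by
      rw [Ne, Finset.sum_eq_zero_iff, not_forall]
      exact ⟨s, by simp⟩
    rw [h2] at h3
    obtain ⟨t, -, ht⟩ := Finset.exists_ne_zero_of_sum_ne_zero h3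
    have h4 := Finsupp.single_apply_ne_zero.1 ht
    rw [mkEdge_eq_iff] at h4
    rcases h4.1 with h5 | h5
    · exact (ha.injective h5.1).trans (hb.injective h5.2).symm
    · exact absurd h5.1 (h _ _)
  refine totalDegree_sum_monomial (det_eq_sum_monomial h) (fun h0 => h1 (by rw [h0, coeff_zero]))
    3 fun π => ?_
  simp [map_sum]

end Minors

/-! ### Leading terms of master polynomials, via lifts to the universal cover -/

section Masters

/-- Positions of a sequence of vertices on the universal cover of the circle. -/
def liftPos {k : ℕ} (z : Fin n) (f : Fin (2 * k + 1) → Fin n) (l : ℕ) : ℕ :=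
  (f (Fin.ofNat _ l) - z).val + n * (l / (2 * k + 1))

lemma sub_val (u v : Fin n) :
    (u - v).val = if v.val ≤ u.val then u.val - v.val else n + u.val - v.val := by
  have := u.isLt
  have := v.isLt
  rw [Fin.sub_def]
  split_ifs with h
  · simp only
    rw [show n - v.val + u.val = (u.val - v.val) + n by omega, Nat.add_mod_right,
      Nat.mod_eq_of_lt (by omega)]
  · simp only
    rw [Nat.mod_eq_of_lt (by omega)]
    omega

/-- Lifts less than one turn apart lie on the same sheet or on consecutive sheets. -/
lemma sub_val_eq_of_lift {z a b : Fin n} {q r : ℕ}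
    (h1 : (a - z).val + n * q ≤ (b - z).val + n * r)
    (h2 : (b - z).val + n * r < (a - z).val + n * q + n) :
    (b - a).val = ((b - z).val + n * r) - ((a - z).val + n * q) := by
  have ha := (a - z).isLt
  have hb := (b - z).isLt
  have hqr : r = q ∨ r = q + 1 := by
    have h3 : q < r + 1 := by
      by_contra hcon
      have := Nat.mul_le_mul_left n (not_lt.1 hcon)
      rw [mul_add] at this
      omega
    have h4 : r < q + 2 := by
      by_contra hcon
      have := Nat.mul_le_mul_left n (not_lt.1 hcon)
      rw [mul_add] at this
      omega
    omega
  have := z.isLt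
  have := a.isLt
  have := b.isLt
  have e1 := sub_val b a
  have e2 := sub_val b z
  have e3 := sub_val a z
  generalize (b - a).val = u at *
  generalize (b - z).val = v at *
  generalize (a - z).val = w at *
  rcases hqr with rfl | rfl
  · split_ifs at * <;> omega
  · rw [mul_add] at *
    split_ifs at * <;> omega

variable {k : ℕ} {i j : Fin (2 * k + 1) → Fin n}

lemma liftPos_add_period (z : Fin n) (f : Fin (2 * k + 1) → Fin n) (l : ℕ) :
    liftPos z f (l + (2 * k + 1)) = liftPos z f l + n := by
  have : Fin.ofNat (2 * k + 1) (l + (2 * k + 1)) = Fin.ofNat (2 * k + 1) l := by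
    ext; simp [Fin.ofNat]
  rw [liftPos, liftPos, this, Nat.add_div_right _ (by omega)]
  ring

lemma IsAdmissible.lift_le (h : IsAdmissible k i j) (l : ℕ) :
    liftPos (i 0) i l ≤ liftPos (i 0) j l :=
  Nat.add_le_add_right (h.i_le_j _) _

lemma IsAdmissible.lift_lt (h : IsAdmissible k i j) (l : ℕ) :
    liftPos (i 0) j l < liftPos (i 0) i (l + 1) := by
  unfold liftPos
  by_cases hl : l % (2 * k + 1) = 2 * k
  · have h1 : (l + 1) / (2 * k + 1) = l / (2 * k + 1) + 1 :=
      Nat.succ_div_of_dvd (Nat.dvd_of_mod_eq_zero (by rw [Nat.add_mod, hl]; simp))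
    rw [h1, mul_add]
    have := (j (Fin.ofNat _ l) - i 0).isLt
    omega
  · have h0 : l % (2 * k + 1) < 2 * k + 1 := Nat.mod_lt _ (by omega)
    have h1 : (l + 1) / (2 * k + 1) = l / (2 * k + 1) := by
      rw [Nat.succ_div, if_neg, add_zero]
      intro hd
      have := Nat.mod_eq_zero_of_dvd hd
      rw [Nat.add_mod] at this
      by_cases hk : k = 0
      · subst hk; omega
      rw [Nat.mod_eq_of_lt (a := 1) (by omega), Nat.mod_eq_of_lt (by omega)] at this
      omega
    rw [h1]
    refine Nat.add_lt_add_right (h.j_lt_i _ _ ?_) _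
    rw [Fin.lt_def]
    simp only [Fin.ofNat]
    by_cases hk : k = 0
    · subst hk; omega
    rw [Nat.add_mod, Nat.mod_eq_of_lt (a := 1) (by omega), Nat.mod_eq_of_lt (a := _ + 1) (by omega)]
    omega

/-- A vertex `b` lies `w` steps after a vertex `a`, by comparison of lifts of `a` and `b`. -/
lemma sub_val_liftPos {z : Fin n} {f g : Fin (2 * k + 1) → Fin n} {l r : ℕ}
    (h1 : liftPos z f l ≤ liftPos z g r) (h2 : liftPos z g r < liftPos z f l + n) :
    (g (Fin.ofNat _ r) - f (Fin.ofNat _ l)).val = liftPos z g r - liftPos z f l :=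
  sub_val_eq_of_lift h1 h2

lemma ne_of_liftPos {z : Fin n} {f g : Fin (2 * k + 1) → Fin n} {l r : ℕ}
    (h1 : liftPos z f l < liftPos z g r) (h2 : liftPos z g r < liftPos z f l + n) :
    f (Fin.ofNat _ l) ≠ g (Fin.ofNat _ r) := by
  intro heq
  have h3 := sub_val_liftPos h1.le h2
  rw [heq, sub_val] at h3
  simp at h3
  omega

lemma IsAdmissible.lift_i_strictMono (h : IsAdmissible k i j) : StrictMono (liftPos (i 0) i) :=
  strictMono_nat_of_lt_succ fun l => (h.lift_le l).trans_lt (h.lift_lt l)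

lemma IsAdmissible.lift_j_strictMono (h : IsAdmissible k i j) : StrictMono (liftPos (i 0) j) :=
  strictMono_nat_of_lt_succ fun l => (h.lift_lt l).trans_le (h.lift_le _)

lemma ofNat_val_add (l : Fin (2 * k + 1)) : Fin.ofNat (2 * k + 1) (l.val + (2 * k + 1)) = l := by
  ext; simp [Fin.ofNat, Nat.mod_eq_of_lt l.isLt]

lemma ofNat_val_add_two (l : Fin (2 * k + 1)) :
    Fin.ofNat (2 * k + 1) (l.val + 2 * k) = l - 1 := by
  rw [eq_sub_iff_add_eq]
  ext
  simp [Fin.ofNat, Fin.val_add, Nat.mod_eq_of_lt l.isLt, add_assoc]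

lemma ofNat_val_add_shift (l : Fin (2 * k + 1)) :
    Fin.ofNat (2 * k + 1) (l.val + (2 * k + 1) + k) = shift k l := by
  ext
  simp only [Fin.ofNat, shift, Fin.val_add]
  rw [Nat.add_mod_mod, add_right_comm, Nat.add_mod_right]

lemma ofNat_val_add_shift_sub_one (l : Fin (2 * k + 1)) :
    Fin.ofNat (2 * k + 1) (l.val + 2 * k + k) = shift k l - 1 := by
  rw [eq_sub_iff_add_eq, ← ofNat_val_add_shift]
  ext
  simp [Fin.ofNat, Fin.val_add]
  congr 1
  omega

/-- The lift of the left end of an edge of a term of a master polynomial. -/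
def leftLift (i j : Fin (2 * k + 1) → Fin n) (S : Finset (Fin (2 * k + 1)))
    (l : Fin (2 * k + 1)) : ℕ :=
  -- All indices are raised by one period, so that `l - 1` becomes `l + 2k` without subtraction in
  -- `ℕ`.
  if l ∈ S then liftPos (i 0) j (l.val + 2 * k) else liftPos (i 0) i (l.val + (2 * k + 1))

/-- The lift of the right end of an edge of a term of a master polynomial. -/
def rightLift (i j : Fin (2 * k + 1) → Fin n) (S : Finset (Fin (2 * k + 1)))
    (l : Fin (2 * k + 1)) : ℕ :=
  if shift k l ∈ S then liftPos (i 0) i (l.val + (2 * k + 1) + k)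
    else liftPos (i 0) j (l.val + 2 * k + k)

lemma leftEnd_eq (S : Finset (Fin (2 * k + 1))) (l : Fin (2 * k + 1)) :
    ∃ (f : Fin (2 * k + 1) → Fin n) (L : ℕ), leftEnd i j S l = f (Fin.ofNat _ L) ∧
      leftLift i j S l = liftPos (i 0) f L := by
  by_cases h : l ∈ S
  · exact ⟨j, _, by rw [leftEnd, if_pos h, ofNat_val_add_two], by rw [leftLift, if_pos h]⟩
  · exact ⟨i, _, by rw [leftEnd, if_neg h, ofNat_val_add], by rw [leftLift, if_neg h]⟩

lemma rightEnd_eq (S : Finset (Fin (2 * k + 1))) (l : Fin (2 * k + 1)) :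
    ∃ (f : Fin (2 * k + 1) → Fin n) (L : ℕ), rightEnd i j S l = f (Fin.ofNat _ L) ∧
      rightLift i j S l = liftPos (i 0) f L := by
  by_cases h : shift k l ∈ S
  · exact ⟨i, _, by rw [rightEnd, if_pos h, ofNat_val_add_shift], by rw [rightLift, if_pos h]⟩
  · exact ⟨j, _, by rw [rightEnd, if_neg h, ofNat_val_add_shift_sub_one],
      by rw [rightLift, if_neg h]⟩

lemma IsAdmissible.leftLift_lt (h : IsAdmissible k i j) (l : Fin (2 * k + 1)) :
    liftPos (i 0) j (l.val + 2 * k) < liftPos (i 0) i (l.val + (2 * k + 1)) :=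
  h.lift_lt _

lemma IsAdmissible.rightLift_lt (h : IsAdmissible k i j) (l : Fin (2 * k + 1)) :
    liftPos (i 0) j (l.val + 2 * k + k) < liftPos (i 0) i (l.val + (2 * k + 1) + k) := by
  convert h.lift_lt (l.val + 2 * k + k) using 2
  omega

lemma IsAdmissible.rightLift_lt_add (h : IsAdmissible k i j) (l : Fin (2 * k + 1)) :
    liftPos (i 0) i (l.val + (2 * k + 1) + k) < liftPos (i 0) j (l.val + 2 * k) + n := by
  rw [← liftPos_add_period]
  refine (h.lift_le _).trans_lt (h.lift_j_strictMono ?_)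
  have := h.one_le
  omega

/-- Strictness needs `isEdge`: for `k = 1` both lifts have the same index modulo 3, and
admissibility gives only `≤`. -/
lemma IsAdmissible.inner_lt (h : IsAdmissible k i j) (l : Fin (2 * k + 1)) :
    liftPos (i 0) i (l.val + (2 * k + 1)) < liftPos (i 0) j (l.val + 2 * k + k) := by
  have hk := h.one_le
  have h1 : liftPos (i 0) i (l.val + (2 * k + 1)) ≤ liftPos (i 0) j (l.val + 2 * k + k) :=
    (h.lift_le _).trans (h.lift_j_strictMono.monotone (by omega))
  refine lt_of_le_of_ne h1 fun heq => h.isEdge l ?_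
  have h2 := sub_val_liftPos h1 (by have := (i 0).isLt; omega)
  rw [ofNat_val_add, ofNat_val_add_shift_sub_one, heq, Nat.sub_self, sub_val] at h2
  ext
  have := (i l).isLt
  split_ifs at h2 <;> omega

lemma IsAdmissible.lift_bounds (h : IsAdmissible k i j) (S : Finset (Fin (2 * k + 1)))
    (l : Fin (2 * k + 1)) : leftLift i j S l < rightLift i j S l ∧
      rightLift i j S l < leftLift i j S l + n := by
  have h1 := h.leftLift_lt l
  have h2 := h.rightLift_lt l
  have h3 := h.rightLift_lt_add l
  have h4 := h.inner_lt l
  unfold leftLift rightLift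
  split_ifs <;> omega

lemma IsAdmissible.leftEnd_ne_rightEnd (h : IsAdmissible k i j) (S : Finset (Fin (2 * k + 1)))
    (l : Fin (2 * k + 1)) : leftEnd i j S l ≠ rightEnd i j S l := by
  obtain ⟨f, L, h1, h2⟩ := leftEnd_eq (i := i) (j := j) S l
  obtain ⟨g, R, h3, h4⟩ := rightEnd_eq (i := i) (j := j) S l
  have h5 := h.lift_bounds S l
  rw [h2, h4] at h5
  rw [h1, h3]
  exact ne_of_liftPos h5.1 h5.2

/-- The `l`-th edge of the term of a master polynomial indexed by `S`. -/
def IsAdmissible.edge (h : IsAdmissible k i j) (S : Finset (Fin (2 * k + 1)))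
    (l : Fin (2 * k + 1)) : Edge n :=
  mkEdge (leftEnd i j S l) (rightEnd i j S l) (h.leftEnd_ne_rightEnd S l)

lemma IsAdmissible.edgeClass_edge (h : IsAdmissible k i j) (S : Finset (Fin (2 * k + 1)))
    (l : Fin (2 * k + 1)) : edgeClass (h.edge S l) =
      min (rightLift i j S l - leftLift i j S l) (n - (rightLift i j S l - leftLift i j S l)) := by
  obtain ⟨f, L, h1, h2⟩ := leftEnd_eq (i := i) (j := j) S l
  obtain ⟨g, R, h3, h4⟩ := rightEnd_eq (i := i) (j := j) S l
  have h5 := h.lift_bounds S l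
  rw [edge, edgeClass_mkEdge]
  rw [h2, h4] at h5 ⊢
  rw [h1, h3, sub_val_liftPos h5.1.le h5.2]

lemma IsAdmissible.edge_ne_iff (h : IsAdmissible k i j) (S : Finset (Fin (2 * k + 1)))
    (l : Fin (2 * k + 1)) : h.edge S l ≠ h.edge ∅ l ↔ l ∈ S ∨ shift k l ∈ S := by
  constructor
  · contrapose!
    rintro ⟨h1, h2⟩
    simp [edge, leftEnd, rightEnd, h1, h2]
  · intro hS
    rw [edge, edge, Ne, mkEdge_eq_iff, not_or]
    have h1 := h.leftLift_lt l
    have h2 := h.rightLift_lt l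
    have h3 := h.rightLift_lt_add l
    have h4 := h.inner_lt l
    refine ⟨fun heq => ?_, fun heq => ?_⟩
    · rcases hS with hS | hS
      · have h5 := ne_of_liftPos h1 (by omega)
        rw [ofNat_val_add_two, ofNat_val_add] at h5
        simp [leftEnd, hS, h5] at heq
      · have h5 := ne_of_liftPos h2 (by omega)
        rw [ofNat_val_add_shift_sub_one, ofNat_val_add_shift] at h5
        simp [rightEnd, hS, h5.symm] at heq
    -- The edges cannot agree with exchanged ends: the new left end lies strictly less than one turn
    -- before the old right end.
    · obtain ⟨f, L, h5, h6⟩ := leftEnd_eq (i := i) (j := j) S l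
      have h7 : liftPos (i 0) f L < liftPos (i 0) j (l.val + 2 * k + k) ∧
          liftPos (i 0) j (l.val + 2 * k + k) < liftPos (i 0) f L + n := by
        rw [← h6, leftLift]
        split_ifs <;> omega
      have h8 := ne_of_liftPos h7.1 h7.2
      rw [← h5, ofNat_val_add_shift_sub_one] at h8
      exact h8 (by simpa [rightEnd] using heq.1)

lemma IsAdmissible.edgeClass_edge_empty_le (h : IsAdmissible k i j) (L : ℕ) :
    edgeClass (h.edge ∅ (Fin.ofNat _ (L + 1))) ≤
      liftPos (i 0) j (L + k) - liftPos (i 0) i (L + 1) := by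
  have hk := h.one_le
  have h1 : liftPos (i 0) i (L + 1) ≤ liftPos (i 0) j (L + k) :=
    (h.lift_le _).trans (h.lift_j_strictMono.monotone (by omega))
  have h2 : liftPos (i 0) j (L + k) < liftPos (i 0) i (L + 1) + n := by
    rw [← liftPos_add_period]
    exact (h.lift_lt _).trans (h.lift_i_strictMono (by omega))
  have h3 : shift k (Fin.ofNat _ (L + 1)) - 1 = Fin.ofNat _ (L + k) := by
    rw [sub_eq_iff_eq_add]
    ext
    simp only [Fin.ofNat, shift, Fin.val_add, Fin.val_one']
    rw [← Nat.add_mod, ← Nat.add_mod, add_right_comm]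
  rw [edge, edgeClass_mkEdge, ← sub_val_liftPos h1 h2, ← h3]
  simp [leftEnd, rightEnd]

/-- Along the short or the complementary arc of a changed edge there is a changed edge that was
shorter before. -/
lemma IsAdmissible.exists_edgeClass_lt (h : IsAdmissible k i j) (S : Finset (Fin (2 * k + 1)))
    (l : Fin (2 * k + 1)) (hl : h.edge S l ≠ h.edge ∅ l) :
    ∃ l', h.edge S l' ≠ h.edge ∅ l' ∧ edgeClass (h.edge ∅ l') < edgeClass (h.edge S l) := by
  have h0 := (h.edge_ne_iff S l).1 hl
  have h1 := h.leftLift_lt l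
  have h2 := h.rightLift_lt l
  have h3 := h.rightLift_lt_add l
  have h4 := h.inner_lt l
  have hw : rightLift i j ∅ l - leftLift i j ∅ l < rightLift i j S l - leftLift i j S l := by
    unfold rightLift leftLift
    rw [if_neg (Finset.notMem_empty _), if_neg (Finset.notMem_empty _)]
    split_ifs with a b b
    · omega
    · omega
    · omega
    · exact absurd h0 (not_or.2 ⟨b, a⟩)
  have hc := h.edgeClass_edge S l
  rcases le_total (rightLift i j S l - leftLift i j S l)
    (n - (rightLift i j S l - leftLift i j S l)) with hle | hle
  -- The class is the width of the new arc, which properly contains the old arc of the same edge.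
  · refine ⟨l, hl, ?_⟩
    rw [h.edgeClass_edge ∅, hc]
    omega
  rw [min_eq_right hle] at hc
  have hb := h.lift_bounds S l
  rcases h0 with h0 | h0
  -- The class is now the length of the complementary arc, which ends at `j_{l-1}`. The old edge
  -- from `i_{l+k+1}` to `j_{l+2k} = j_{l-1}` lies properly inside it and also involves the
  -- transposition `l`.
  · refine ⟨Fin.ofNat _ (l.val + (2 * k + 1) + k + 1), (h.edge_ne_iff _ _).2 (Or.inr ?_), ?_⟩
    · convert h0
      ext
      simp only [Fin.ofNat, shift, Fin.val_add]
      rw [← Nat.add_mod, show l.val + (2 * k + 1) + k + 1 + k = l.val + 2 * (2 * k + 1) by ring,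
        Nat.add_mul_mod_self_right, Nat.mod_eq_of_lt l.isLt]
    · refine (h.edgeClass_edge_empty_le _).trans_lt ?_
      rw [hc, show l.val + (2 * k + 1) + k + k = l.val + 2 * k + (2 * k + 1) by ring,
        liftPos_add_period]
      have h5 : liftPos (i 0) i (l.val + (2 * k + 1) + k) <
        liftPos (i 0) i (l.val + (2 * k + 1) + k + 1) := h.lift_i_strictMono (by omega)
      have h6 : leftLift i j S l = liftPos (i 0) j (l.val + 2 * k) := by
        rw [leftLift, if_pos h0]
      have h7 : rightLift i j S l ≤ liftPos (i 0) i (l.val + (2 * k + 1) + k) := by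
        rw [rightLift]
        split_ifs <;> omega
      omega
  -- The complementary arc starts at `i_{l+k}` and properly contains the old edge from `i_{l+k}` to
  -- `j_{l-2}`, which involves the transposition `l + k`.
  · refine ⟨shift k l, (h.edge_ne_iff _ _).2 (Or.inl h0), ?_⟩
    rw [← ofNat_val_add_shift, show l.val + (2 * k + 1) + k = l.val + 3 * k + 1 by ring]
    refine (h.edgeClass_edge_empty_le _).trans_lt ?_
    have h5 : liftPos (i 0) j (l.val + 3 * k + k) < liftPos (i 0) j (l.val + 2 * k) + n := by
      rw [← liftPos_add_period]
      exact h.lift_j_strictMono (by omega)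
    rw [show l.val + (2 * k + 1) + k = l.val + 3 * k + 1 by ring] at *
    have h6 : rightLift i j S l = liftPos (i 0) i (l.val + 3 * k + 1) := by
      rw [rightLift, if_pos h0, show l.val + (2 * k + 1) + k = l.val + 3 * k + 1 by ring]
    have h7 : liftPos (i 0) j (l.val + 2 * k) ≤ leftLift i j S l := by
      rw [leftLift]
      split_ifs <;> omega
    rw [hc]
    omega

/-- The exponent of the term of a master polynomial indexed by `S`. -/
def IsAdmissible.exponent (h : IsAdmissible k i j) (S : Finset (Fin (2 * k + 1))) :
    Edge n →₀ ℕ := ∑ l, Finsupp.single (h.edge S l) 1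

lemma IsAdmissible.blockLT (h : IsAdmissible k i j) {S : Finset (Fin (2 * k + 1))} (hS : S ≠ ∅) :
    BlockLT edgeClass (h.exponent S) (h.exponent ∅) := by
  refine blockLT_sum_single (h.exists_edgeClass_lt S) ?_
  obtain ⟨l, hl⟩ := Finset.nonempty_iff_ne_empty.2 hS
  exact ⟨l, (h.edge_ne_iff S l).2 (Or.inl hl)⟩

lemma IsAdmissible.masterPolynomial_eq (h : IsAdmissible k i j) :
    masterPolynomial k i j = ∑ S, monomial (h.exponent S) ((-1) ^ S.card) := by
  refine Finset.sum_congr rfl fun S _ => ?_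
  have h1 : ∀ l, x (leftEnd i j S l) (rightEnd i j S l) = X (h.edge S l) := fun l => x_eq_X _ _ _
  simp only [leftEnd, rightEnd] at h1
  simp only [h1, X, exponent]
  rw [← monomial_sum_one, ← C_1, ← C_neg, ← C_pow, C_mul_monomial, mul_one]

lemma IsAdmissible.masterPolynomial_ne_zero (h : IsAdmissible k i j) :
    masterPolynomial k i j ≠ 0 := by
  intro h0
  have := sum_monomial_ne_zero h.masterPolynomial_eq ∅ (by simp) fun S hS => (h.blockLT hS).ne
  exact this (by rw [h0, coeff_zero])

lemma IsAdmissible.degree_masterPolynomial (h : IsAdmissible k i j) {m : MonomialOrder (Edge n)}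
    (hm : IsCircular m) : m.degree (masterPolynomial k i j) = h.exponent ∅ :=
  degree_sum_monomial m h.masterPolynomial_eq ∅ (by simp) fun _ hS => (h.blockLT hS).lt hm

lemma IsAdmissible.totalDegree_masterPolynomial (h : IsAdmissible k i j) :
    (masterPolynomial k i j).totalDegree = 2 * k + 1 :=
  totalDegree_sum_monomial h.masterPolynomial_eq h.masterPolynomial_ne_zero _ fun S => by
    simp [exponent, map_sum]

lemma IsAdmissible.i_injective (h : IsAdmissible k i j) : Function.Injective i := by
  have h1 : ∀ l l', l < l' → i l ≠ i l' := by
    intro l l' hl heq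
    have h2 := (h.i_le_j l).trans_lt (h.j_lt_i l l' hl)
    rw [heq] at h2
    exact lt_irrefl _ h2
  intro l l' heq
  rcases lt_trichotomy l l' with hl | hl | hl
  · exact absurd heq (h1 _ _ hl)
  · exact hl
  · exact absurd heq.symm (h1 _ _ hl)

lemma IsAdmissible.le (h : IsAdmissible k i j) : 2 * k + 1 ≤ n := by
  simpa using Fintype.card_le_of_injective _ h.i_injective

end Masters

/-! ### Finiteness, membership and degrees of the basis -/

section Basis

lemma finite_masterPolynomials_union (n : ℕ) :
    (masterPolynomials n ∪ offDiagonalMinors n).Finite := by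
  refine Set.Finite.union ?_ ?_
  · refine (Set.finite_iUnion (ι := Fin (n + 1)) fun k => Set.finite_range
      fun p : (Fin (2 * k.val + 1) → Fin n) × (Fin (2 * k.val + 1) → Fin n) =>
        masterPolynomial k.val p.1 p.2).subset ?_
    rintro _ ⟨k, i, j, h, rfl⟩
    have := h.le
    exact Set.mem_iUnion.2 ⟨⟨k, by omega⟩, (i, j), rfl⟩
  · refine (Set.finite_range fun p : (Fin 3 → Fin n) × (Fin 3 → Fin n) =>
      (Matrix.of fun s t => x (p.1 s) (p.2 t)).det).subset ?_
    rintro _ ⟨a, b, -, -, -, rfl⟩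
    exact ⟨(a, b), rfl⟩

lemma masterPolynomials_union_subset (n : ℕ) : masterPolynomials n ∪ offDiagonalMinors n ⊆
    (secantIdeal 2 (toricIdeal n) : Set (MvPolynomial (Edge n) ℂ)) := by
  rintro _ (⟨k, i, j, h, rfl⟩ | ⟨a, b, -, -, h, rfl⟩)
  · exact masterPolynomial_mem_secantIdeal h.leftEnd_ne_rightEnd
  · exact det_mem_secantIdeal h

/-- For `k = 1` six distinct vertices are needed; for `k ≥ 2` one may take `i = j`. -/
lemma exists_isAdmissible {k : ℕ} (hk : 1 ≤ k) (hn : 2 * k + 1 ≤ n) (h3 : k = 1 → 6 ≤ n) :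
    ∃ i j : Fin (2 * k + 1) → Fin n, IsAdmissible k i j := by
  by_cases h1 : k = 1
  · subst h1
    have h6 := h3 rfl
    refine ⟨fun l => ⟨2 * l.val, by omega⟩, fun l => ⟨2 * l.val + 1, by omega⟩, le_rfl,
      fun l => ?_, fun l l' hl => ?_, fun l => ?_⟩
    · simp [sub_val]
    · rw [Fin.lt_def] at hl
      simp [sub_val]
      omega
    · rw [show shift 1 l - 1 = l by fin_cases l <;> rfl]
      simp
  · refine ⟨Fin.castLE hn, Fin.castLE hn, hk, fun l => le_rfl, fun l l' hl => ?_, fun l => ?_⟩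
    · rw [Fin.lt_def] at hl
      simpa [sub_val] using hl
    · rw [Ne, (Fin.castLE_injective hn).eq_iff, eq_sub_iff_add_eq, shift, add_right_inj, Fin.ext_iff]
      simp only [Fin.ofNat, Fin.val_one']
      rw [Nat.mod_eq_of_lt (by omega), Nat.mod_eq_of_lt (by omega)]
      omega

lemma totalDegree_image (n : ℕ) :
    totalDegree '' (masterPolynomials n ∪ offDiagonalMinors n) =
      {d : ℕ | Odd d ∧ 3 ≤ d ∧ d ≤ n ∧ (d = 3 → 6 ≤ n)} := by
  ext d
  constructor
  · rintro ⟨_, ⟨k, i, j, h, rfl⟩ | hf, rfl⟩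
    · rw [h.totalDegree_masterPolynomial]
      have h1 := h.one_le
      refine ⟨⟨k, rfl⟩, by omega, h.le, fun hk => ?_⟩
      obtain rfl : k = 1 := by omega
      -- For `k = 1` the edges are `i_l j_l`, so all six vertices are distinct and `n ≥ 6`.
      have h2 : ∀ l, (i l - i 0).val < (j l - i 0).val := by
        intro l
        refine lt_of_le_of_ne (h.i_le_j l) fun heq => h.isEdge l ?_
        rw [show shift 1 l - 1 = l by fin_cases l <;> rfl]
        ext
        have := (i l).isLt
        have := (j l).isLt
        have := (i 0).isLt
        rw [sub_val, sub_val] at heq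
        split_ifs at heq <;> omega
      have h3 := h.j_lt_i 0 1 (by decide)
      have h4 := h.j_lt_i 1 2 (by decide)
      have h5 := h2 0
      have h6 := h2 1
      have h7 := h2 2
      have := (j 2 - i 0).isLt
      omega
    · rw [totalDegree_of_mem_offDiagonalMinors hf]
      obtain ⟨a, b, ha, hb, h, rfl⟩ := hf
      have h1 : 6 ≤ n := by
        have : Function.Injective (Sum.elim a b) := ha.injective.sumElim hb.injective h
        simpa using Fintype.card_le_of_injective _ this
      exact ⟨by decide, le_rfl, by omega, fun _ => h1⟩
  · rintro ⟨⟨k, rfl⟩, h3, hn, h6⟩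
    obtain ⟨i, j, h⟩ := exists_isAdmissible (n := n) (k := k) (by omega) hn
      fun hk => h6 (by omega)
    exact ⟨_, Or.inl ⟨k, i, j, h, rfl⟩, h.totalDegree_masterPolynomial⟩

end Basis

/-! ### Cyclic systems of arcs in which exactly the consecutive ones are disjoint -/

section Arcs

/-- The closed arcs from `s` to `t` and from `s'` to `t'` of a circle, cut open, are disjoint. -/
def ArcDisj (s t s' t' : ℕ) : Prop :=
  (s ≤ t ∧ t < s' ∧ s' ≤ t') ∨ (s' ≤ t' ∧ t' < s ∧ s ≤ t) ∨
    (t < s ∧ t < s' ∧ s' ≤ t' ∧ t' < s) ∨ (t' < s' ∧ t' < s ∧ s ≤ t ∧ t < s')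

lemma ArcDisj.symm {s t s' t' : ℕ} (h : ArcDisj s t s' t') : ArcDisj s' t' s t := by
  unfold ArcDisj at *; omega

lemma arcDisj_iff {n : ℕ} (s t s' t' : Fin n) :
    ArcDisj s t s' t' ↔ (t - s).val < (s' - s).val ∧ (t' - s').val < (s - s').val := by
  have i1 := s.isLt
  have i2 := t.isLt
  have i3 := s'.isLt
  have i4 := t'.isLt
  rw [sub_val, sub_val, sub_val, sub_val]
  unfold ArcDisj
  generalize s.val = a at i1 ⊢
  generalize t.val = b at i2 ⊢
  generalize s'.val = c at i3 ⊢
  generalize t'.val = d at i4 ⊢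
  rcases Nat.lt_or_ge b a with h1 | h1 <;> rcases Nat.lt_or_ge d c with h2 | h2 <;>
    rcases Nat.lt_or_ge a c with h3 | h3 <;> rcases Nat.lt_or_ge c a with h4 | h4 <;>
    simp only [h1, h2, h3, h4, not_lt.2, not_le.2, if_true, if_false, true_and, false_and, and_true,
      and_false, false_or, or_false, false_iff] <;> omega

/-- Disjointness does not depend on where the circle is cut, so the cut may be placed at the start
of any chosen arc. -/
lemma arcDisj_rotate {n : ℕ} (z s t s' t' : Fin n) :
    ArcDisj (s - z).val (t - z).val (s' - z).val (t' - z).val ↔ ArcDisj s t s' t' := by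
  have : NeZero n := ⟨by have := z.isLt; omega⟩
  have key : ∀ a b : Fin n, a - z - (b - z) = a - b := fun a b => sub_sub_sub_cancel_right a b z
  simp only [arcDisj_iff, key]

/-- A sufficient condition for the inclusion of an arc in another one. -/
def ArcSub (s t s' t' : ℕ) : Prop :=
  (s' ≤ s ∧ s ≤ t ∧ t ≤ t') ∨ (t' < s' ∧ s ≤ t ∧ (s' ≤ s ∨ t ≤ t')) ∨
    (t < s ∧ t ≤ t' ∧ t' < s' ∧ s' ≤ s)

lemma ArcSub.arcDisj {s t s' t' p q : ℕ} (h : ArcSub s t s' t') (h' : ArcDisj s' t' p q) :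
    ArcDisj s t p q := by
  unfold ArcSub ArcDisj at *; omega

/-- A cyclic sequence of arcs of which exactly the consecutive ones are disjoint. -/
def ArcSystem {N : ℕ} (s t : ZMod N → ℕ) : Prop :=
  ∀ l l', ArcDisj (s l) (t l) (s l') (t l') ↔ l' = l + 1 ∨ l = l' + 1

variable {k : ℕ}

lemma zmod_natCast_ne_zero {N a : ℕ} (ha : 0 < a) (haN : a < N) : (a : ZMod N) ≠ 0 := by
  rw [Ne, ZMod.natCast_eq_zero_iff]
  exact fun h => absurd (Nat.le_of_dvd ha h) (not_le.2 haN)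

namespace ArcSystem

variable {s t : ZMod (2 * k + 1) → ℕ}

lemma disj_succ (h : ArcSystem s t) (l : ZMod (2 * k + 1)) :
    ArcDisj (s l) (t l) (s (l + 1)) (t (l + 1)) := (h _ _).2 (Or.inl rfl)

lemma not_disj_two (h : ArcSystem s t) (hk : 2 ≤ k) (l : ZMod (2 * k + 1)) :
    ¬ ArcDisj (s l) (t l) (s (l + 2)) (t (l + 2)) := by
  rw [h]
  rintro (h1 | h1)
  · exact zmod_natCast_ne_zero (N := 2 * k + 1) (a := 1) (by omega) (by omega)
      (by push_cast; linear_combination h1)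
  · exact zmod_natCast_ne_zero (N := 2 * k + 1) (a := 3) (by omega) (by omega)
      (by push_cast; linear_combination -h1)

lemma not_disj_three (h : ArcSystem s t) (hk : 2 ≤ k) (l : ZMod (2 * k + 1)) :
    ¬ ArcDisj (s l) (t l) (s (l + 3)) (t (l + 3)) := by
  rw [h]
  rintro (h1 | h1)
  · exact zmod_natCast_ne_zero (N := 2 * k + 1) (a := 2) (by omega) (by omega)
      (by push_cast; linear_combination h1)
  · exact zmod_natCast_ne_zero (N := 2 * k + 1) (a := 4) (by omega) (by omega)
      (by push_cast; linear_combination -h1)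

/-- An arc inside arc `m` is disjoint from the arcs `m + 1` and `m - 1`. Being different from `m`,
its index `l` would satisfy `l = m + 2` and `m = l + 2`, hence `4 = 0` modulo `2k + 1 ≥ 5`. -/
lemma not_sub (h : ArcSystem s t) (hk : 2 ≤ k) {l m : ZMod (2 * k + 1)} (hlm : l ≠ m) :
    ¬ ArcSub (s l) (t l) (s m) (t m) := by
  intro hs
  have h1 := (h _ _).1 (hs.arcDisj (h.disj_succ m))
  have h2 := (h _ _).1 (hs.arcDisj ((h m (m - 1)).2 (Or.inr (by ring))))
  have h3 : l = m + 2 := by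
    rcases h1 with h1 | h1
    · exact absurd (by linear_combination -h1) hlm
    · linear_combination h1
  have h4 : m = l + 2 := by
    rcases h2 with h2 | h2
    · linear_combination h2
    · exact absurd (by linear_combination h2) hlm
  exact zmod_natCast_ne_zero (N := 2 * k + 1) (a := 4) (by omega) (by omega)
    (by push_cast; linear_combination -h3 - h4)

lemma ne_add (hk : 2 ≤ k) (l : ZMod (2 * k + 1)) : l ≠ l + 2 := fun h =>
  zmod_natCast_ne_zero (N := 2 * k + 1) (a := 2) (by omega) (by omega)
    (by push_cast; linear_combination -h)

/-- The start of the second next arc lies in an arc. -/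
def Right (s t : ZMod (2 * k + 1) → ℕ) (l : ZMod (2 * k + 1)) : Prop :=
  ¬ ArcDisj (s (l + 2)) (s (l + 2)) (s l) (t l)

/-- Cut at the start of arc `l`. Arcs `l` and `l + 2` both avoid arc `l + 1`, and arc `l + 2` is not
contained in arc `l`, so it sticks out beyond its end. -/
lemma right_bounds (h : ArcSystem s t) (hk : 2 ≤ k) (l : ZMod (2 * k + 1)) (h0 : s l = 0)
    (hr : Right s t l) : t l < s (l + 1) ∧ s (l + 1) ≤ t (l + 1) ∧ s (l + 2) ≤ t l ∧
      t l < t (l + 2) ∧ t (l + 2) < s (l + 1) := by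
  have d01 := h.disj_succ l
  have d12 := h.disj_succ (l + 1)
  have n20 := h.not_sub hk (ne_add hk l).symm
  unfold Right at hr
  rw [show l + 1 + 1 = l + 2 by ring] at d12
  rw [h0] at *
  generalize s (l + 1) = s1 at *
  generalize t (l + 1) = t1 at *
  generalize s (l + 2) = s2 at *
  generalize t (l + 2) = t2 at *
  generalize t l = t0 at *
  have e1 : t0 < s1 ∧ s1 ≤ t1 := by unfold ArcDisj at d01; omega
  have e2 : s2 ≤ t0 := by unfold ArcDisj at hr; omega
  have e3 : s2 ≤ t2 ∧ t2 < s1 := by unfold ArcDisj at d12; omega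
  have e4 : t0 < t2 := by unfold ArcSub at n20; omega
  exact ⟨e1.1, e1.2, e2, e4, e3.2⟩

/-- Arc `l + 3` avoids arc `l + 2` but meets arcs `l` and `l + 1`, so it has to pass over the cut.
-/
lemma right_bounds_three (h : ArcSystem s t) (hk : 2 ≤ k) (l : ZMod (2 * k + 1)) (h0 : s l = 0)
    (hr : Right s t l) : s (l + 1) < s (l + 3) ∧ s (l + 3) ≤ t (l + 1) ∧ t (l + 3) < s (l + 2) := by
  obtain ⟨e1, e2, e3, e4, e5⟩ := h.right_bounds hk l h0 hr
  have d23 := h.disj_succ (l + 2)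
  have d03 := h.not_disj_three hk l
  have d13 := h.not_disj_two hk (l + 1)
  have n13 := h.not_sub hk (ne_add hk (l + 1))
  rw [show l + 2 + 1 = l + 3 by ring] at d23
  rw [show l + 1 + 2 = l + 3 by ring] at *
  rw [h0] at *
  generalize s (l + 1) = s1 at *
  generalize t (l + 1) = t1 at *
  generalize s (l + 2) = s2 at *
  generalize t (l + 2) = t2 at *
  generalize s (l + 3) = s3 at *
  generalize t (l + 3) = t3 at *
  generalize t l = t0 at *
  have e6 : t3 < s3 ∧ t3 < s2 ∧ t2 < s3 := by
    rcases d23 with d | d | d | d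
    · exact absurd (by unfold ArcDisj; omega) d03
    · exact absurd (by unfold ArcDisj; omega) d13
    · omega
    · omega
  have e7 : s1 < s3 := by
    by_contra hcon
    exact n13 (by unfold ArcSub; omega)
  have e8 : s3 ≤ t1 := by
    by_contra hcon
    exact d13 (by unfold ArcDisj; omega)
  exact ⟨e7, e8, e6.2.1⟩

lemma right_succ (h : ArcSystem s t) (hk : 2 ≤ k) (l : ZMod (2 * k + 1)) (h0 : s l = 0)
    (hr : Right s t l) : Right s t (l + 1) := by
  obtain ⟨e1, e2, -⟩ := h.right_bounds_three hk l h0 hr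
  unfold Right ArcDisj
  rw [show l + 1 + 2 = l + 3 by ring]
  omega

/-- No arc starts strictly between the starts of an arc and of the second next one. -/
lemma start_between (h : ArcSystem s t) (hk : 2 ≤ k) (l p : ZMod (2 * k + 1)) (h0 : s l = 0)
    (hr : Right s t l) (hp : ¬ ArcDisj (s p) (s p) (s l) (s (l + 2))) : p = l ∨ p = l + 2 := by
  by_contra! hcon
  obtain ⟨e1, e2, e3, e4, e5⟩ := h.right_bounds hk l h0 hr
  have n2p := h.not_sub hk hcon.2.symm
  have dp1 : ¬ ArcDisj (s p) (t p) (s (l + 1)) (t (l + 1)) := by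
    rw [h]
    rintro (h1 | h1)
    · exact hcon.1 (by linear_combination -h1)
    · exact hcon.2 (by linear_combination h1)
  rw [h0] at hp
  have e6 : s p ≤ s (l + 2) := by
    by_contra hcon
    exact hp (by unfold ArcDisj; omega)
  have e7 : s p ≤ t p := by
    by_contra hcon
    exact n2p (by unfold ArcSub; omega)
  have e8 : t p < t (l + 2) := by
    by_contra hcon
    exact n2p (by unfold ArcSub; omega)
  -- The arc `p` is confined to the stretch before `t (l + 2)`, so it misses arc `l + 1`; but only
  -- the neighbours `l` and `l + 2` may do so.
  exact dp1 (by unfold ArcDisj; omega)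

/-- The third next arc ends between the starts of an arc and of the second next one. -/
lemma end_between (h : ArcSystem s t) (hk : 2 ≤ k) (l : ZMod (2 * k + 1)) (h0 : s l = 0)
    (hr : Right s t l) : ¬ ArcDisj (t (l + 3)) (t (l + 3)) (s l) (s (l + 2)) ∧
      t (l + 3) ≠ s (l + 2) := by
  obtain ⟨-, -, e3⟩ := h.right_bounds_three hk l h0 hr
  unfold ArcDisj
  omega

end ArcSystem

end Arcs

/-! ### Induced odd cycles in the graph of separated edges -/

section OddCycles

/-- A graph that is not bipartite has an induced odd cycle. -/
lemma exists_induced_odd_cycle {V : Type*} {G : SimpleGraph V} (hG : ¬ G.Colorable 2) :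
    ∃ k, 1 ≤ k ∧ ∃ c : ZMod (2 * k + 1) → V,
      ∀ l l', G.Adj (c l) (c l') ↔ l' = l + 1 ∨ l = l' + 1 := by
  classical
  have hex : ∃ N, ∃ c : ℕ → V, Odd N ∧ c N = c 0 ∧ ∀ l < N, G.Adj (c l) (c (l + 1)) := by
    rw [SimpleGraph.two_colorable_iff_forall_loop_even] at hG
    push Not at hG
    obtain ⟨v, w, hw⟩ := hG
    exact ⟨w.length, w.getVert, by simpa using hw, by simp, fun l hl => w.adj_getVert_succ hl⟩
  -- A shortest closed walk of odd length is an induced cycle.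
  obtain ⟨c, hodd, hc0, hadj⟩ := Nat.find_spec hex
  have hmin := fun {q : ℕ} => Nat.find_min hex (m := q)
  generalize Nat.find hex = N at *
  have hN1 : N ≠ 1 := by
    rintro rfl
    have := hadj 0 one_pos
    rw [zero_add, hc0] at this
    exact G.loopless.irrefl _ this
  obtain ⟨k, rfl⟩ := hodd
  set N := 2 * k + 1 with hN
  have hper : ∀ l, c ((l + N) % N) = c (l % N) := fun l => by rw [Nat.add_mod_right]
  have hstep : ∀ l, G.Adj (c (l % N)) (c ((l + 1) % N)) := by
    intro l
    have h1 := hadj _ (Nat.mod_lt l (by omega : 0 < N))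
    by_cases h2 : l % N + 1 = N
    · rw [h2, hc0] at h1
      rw [Nat.add_mod, Nat.mod_eq_of_lt (by omega : 1 < N), h2, Nat.mod_self]
      exact h1
    · have h3 := Nat.mod_lt l (by omega : 0 < N)
      rw [Nat.add_mod, Nat.mod_eq_of_lt (by omega : 1 < N),
        Nat.mod_eq_of_lt (by omega : l % N + 1 < N)]
      exact h1
  -- A chord spanning an even number of steps closes them to a shorter odd walk. If a chord spans an
  -- odd number, the complementary path is even.
  have heven : ∀ p q, Even q → q + 1 < N → ¬ G.Adj (c (p % N)) (c ((p + q) % N)) := by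
    intro p q hq hqN had
    refine hmin hqN ⟨fun t => if t ≤ q then c ((p + t) % N) else c (p % N), hq.add_one,
      by simp, fun l hl => ?_⟩
    rcases Nat.lt_or_ge l q with h1 | h1
    · simp only [if_pos h1.le, if_pos (Nat.succ_le_of_lt h1)]
      exact hstep (p + l)
    · obtain rfl : l = q := by omega
      simpa using had.symm
  have hchord : ∀ p q, 2 ≤ q → q + 2 ≤ N → ¬ G.Adj (c (p % N)) (c ((p + q) % N)) := by
    intro p q h2 hqN had
    rcases Nat.even_or_odd q with hq | hq
    · exact heven p q hq (by omega) had
    · refine heven (p + q) (N - q) ?_ (by omega) ?_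
      · obtain ⟨r, rfl⟩ := hq
        exact ⟨k - r, by omega⟩
      · rw [show p + q + (N - q) = p + N by omega, hper]
        exact had.symm
  have hval : ∀ z : ZMod N, c z.val = c (z.val % N) := fun z => by
    rw [Nat.mod_eq_of_lt z.val_lt]
  have hsucc : ∀ z : ZMod N, G.Adj (c z.val) (c (z + 1).val) := by
    intro z
    have := hstep z.val
    rwa [hval z, ZMod.val_add, ZMod.val_one_eq_one_mod, Nat.add_mod_mod]
  refine ⟨k, by omega, fun z => c z.val, fun z w => ⟨fun had => ?_, ?_⟩⟩
  · have hlt := (w - z).val_lt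
    have hw : w = z + ((w - z).val : ZMod N) := by rw [ZMod.natCast_zmod_val]; ring
    have hwv : w.val = (z.val + (w - z).val) % N := by
      rw [← ZMod.val_add]; congr 1; ring
    by_cases h0 : (w - z).val = 0
    · rw [h0] at hw
      rw [show w = z by simpa using hw] at had
      exact absurd had (G.loopless.irrefl _)
    by_cases h1 : (w - z).val = 1
    · left
      rw [h1] at hw
      simpa using hw
    by_cases h2 : (w - z).val = 2 * k
    · right
      rw [h2] at hw
      have : ((2 * k + 1 : ℕ) : ZMod N) = 0 := ZMod.natCast_self N
      push_cast at this hw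
      linear_combination -hw - this
    · simp only [hval z, hwv] at had
      exact absurd had (hchord _ _ (by omega) (by omega))
  · rintro (rfl | rfl)
    · exact hsucc z
    · exact (hsucc w).symm

variable {n : ℕ}

/-- If a multigraph is not the sum of two multigraphs with pairwise touching or crossing edges,
then its edges contain an odd cycle for the relation of being disjoint and noncrossing. -/
lemma exists_odd_cycle_of_not_std {u : Edge n →₀ ℕ}
    (hu : ∀ a b, a + b = u → Std a → Std b → False) :
    ∃ k, 1 ≤ k ∧ ∃ c : ZMod (2 * k + 1) → Edge n, (∀ l, u (c l) ≠ 0) ∧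
      ∀ l l', Sep (c l) (c l') ↔ l' = l + 1 ∨ l = l' + 1 := by
  classical
  let G : SimpleGraph (Edge n) :=
    { Adj := fun e f => u e ≠ 0 ∧ u f ≠ 0 ∧ Sep e f
      symm := ⟨fun e f h => ⟨h.2.1, h.1, h.2.2.symm⟩⟩
      loopless := ⟨fun e h => Sep.irrefl e h.2.2⟩ }
  have hG : ¬ G.Colorable 2 := by
    rintro ⟨C⟩
    refine hu (u.filter fun e => C e = 0) (u.filter fun e => ¬ C e = 0)
      (Finsupp.filter_add_filter_not _ _) ?_ ?_
    · intro e f he hf hs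
      simp only [Finsupp.filter_apply, ne_eq, ite_eq_right_iff, not_forall] at he hf
      obtain ⟨he, he'⟩ := he
      obtain ⟨hf, hf'⟩ := hf
      exact C.valid (v := e) (w := f) ⟨he', hf', hs⟩ (he.trans hf.symm)
    · intro e f he hf hs
      simp only [Finsupp.filter_apply, ne_eq, ite_eq_right_iff, not_forall] at he hf
      obtain ⟨he, he'⟩ := he
      obtain ⟨hf, hf'⟩ := hf
      exact C.valid (v := e) (w := f) ⟨he', hf', hs⟩ (by omega)
  obtain ⟨k, hk, c, hc⟩ := exists_induced_odd_cycle hG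
  have hu : ∀ l, u (c l) ≠ 0 := fun l => ((hc l (l + 1)).2 (Or.inl rfl)).1
  exact ⟨k, hk, c, hu, fun l l' => by simpa [G, hu] using hc l l'⟩

end OddCycles

/-! ### From cycles of edges to arc systems and admissible pairs -/

section ArcsOfEdges

variable {n : ℕ} {k : ℕ}

/-- The start of the arc bounded by the edge `e` that avoids `f`. -/
def arcStart (e f : Edge n) : Fin n := if e.1.1 < f.1.1 ∧ f.1.2 < e.1.2 then e.1.2 else e.1.1

/-- The end of the arc bounded by the edge `e` that avoids `f`. -/
def arcStop (e f : Edge n) : Fin n := if e.1.1 < f.1.1 ∧ f.1.2 < e.1.2 then e.1.1 else e.1.2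

lemma arcStart_ne_arcStop (e f : Edge n) : arcStart e f ≠ arcStop e f := by
  have := e.2.ne
  unfold arcStart arcStop
  split_ifs
  · exact this.symm
  · exact this

lemma mkEdge_arc (e f : Edge n) (h : arcStart e f ≠ arcStop e f) :
    mkEdge (arcStart e f) (arcStop e f) h = e := by
  have := e.2
  unfold mkEdge arcStart arcStop
  grind

lemma sep_of_arcDisj {e f e' f' : Edge n}
    (h : ArcDisj (arcStart e e') (arcStop e e') (arcStart f f') (arcStop f f')) : Sep e f := by
  have h1 : e.1.1.val < e.1.2.val := e.2
  have h2 : f.1.1.val < f.1.2.val := f.2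
  unfold arcStart arcStop at h
  unfold ArcDisj at h
  simp only [Sep, Fin.lt_def]
  split_ifs at h <;> omega

/-- Since `e` and `g` touch or cross, they lie on the same side of `f`; the arc of `f` avoiding `g`
therefore avoids `e` too. -/
lemma arcDisj_of_sep {e f g : Edge n} (h1 : Sep e f) (h2 : Sep f g) (h3 : ¬ Sep e g) :
    ArcDisj (arcStart e f) (arcStop e f) (arcStart f g) (arcStop f g) := by
  have e1 : e.1.1.val < e.1.2.val := e.2
  have e2 : f.1.1.val < f.1.2.val := f.2
  have e3 : g.1.1.val < g.1.2.val := g.2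
  unfold arcStart arcStop
  unfold ArcDisj
  simp only [Sep, Fin.lt_def] at *
  split_ifs <;> omega

lemma arcSystem_of_sep (hk : 2 ≤ k) {c : ZMod (2 * k + 1) → Edge n}
    (hc : ∀ l l', Sep (c l) (c l') ↔ l' = l + 1 ∨ l = l' + 1) :
    ArcSystem (fun l => (arcStart (c l) (c (l + 1))).val)
      (fun l => (arcStop (c l) (c (l + 1))).val) := by
  have key : ∀ l, ArcDisj (arcStart (c l) (c (l + 1))) (arcStop (c l) (c (l + 1)))
      (arcStart (c (l + 1)) (c (l + 1 + 1))) (arcStop (c (l + 1)) (c (l + 1 + 1))) := by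
    intro l
    refine arcDisj_of_sep ((hc _ _).2 (Or.inl rfl)) ((hc _ _).2 (Or.inl rfl)) fun h => ?_
    rcases (hc _ _).1 h with h1 | h1
    · exact zmod_natCast_ne_zero (N := 2 * k + 1) (a := 1) (by omega) (by omega)
        (by push_cast; linear_combination h1)
    · exact zmod_natCast_ne_zero (N := 2 * k + 1) (a := 3) (by omega) (by omega)
        (by push_cast; linear_combination -h1)
  intro l l'
  constructor
  · intro h
    exact (hc _ _).1 (sep_of_arcDisj h)
  · rintro (rfl | rfl)
    · exact key l
    · exact (key l').symm

namespace ArcSystem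

lemma start_inj {s t : ZMod (2 * k + 1) → ℕ} (h : ArcSystem s t) (hk : 2 ≤ k)
    {l m : ZMod (2 * k + 1)} (hs : s l = s m) : l = m := by
  by_contra hne
  have h1 := h.not_sub hk hne
  have h2 := h.not_sub hk (Ne.symm hne)
  unfold ArcSub at *
  omega

variable {σ τ : ZMod (2 * k + 1) → Fin n}

lemma rotate (h : ArcSystem (fun l => (σ l).val) (fun l => (τ l).val)) (z : Fin n) :
    ArcSystem (fun l => (σ l - z).val) (fun l => (τ l - z).val) := fun l l' => by
  rw [arcDisj_rotate]
  exact h l l'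

lemma right_rotate (z : Fin n) (l : ZMod (2 * k + 1)) :
    Right (fun l => (σ l - z).val) (fun l => (τ l - z).val) l ↔
      Right (fun l => (σ l).val) (fun l => (τ l).val) l := by
  unfold Right
  rw [arcDisj_rotate]

lemma sub_self_val (z : Fin n) : (z - z).val = 0 := by simp [sub_val]

lemma right_all (h : ArcSystem (fun l => (σ l).val) (fun l => (τ l).val)) (hk : 2 ≤ k)
    {l : ZMod (2 * k + 1)} (hr : Right (fun l => (σ l).val) (fun l => (τ l).val) l)
    (m : ZMod (2 * k + 1)) : Right (fun l => (σ l).val) (fun l => (τ l).val) m := by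
  have h1 : ∀ q : ℕ, Right (fun l => (σ l).val) (fun l => (τ l).val) (l + q) := by
    intro q
    induction q with
    | zero => simpa using hr
    | succ q ih =>
      have h2 := (h.rotate (σ (l + q))).right_succ hk (l + q) (sub_self_val _)
        ((right_rotate _ _).2 ih)
      rw [right_rotate] at h2
      rwa [Nat.cast_succ, ← add_assoc]
  have h2 := h1 (m - l).val
  rwa [ZMod.natCast_zmod_val, add_sub_cancel] at h2

/-- With `i_l = σ (2l)` and `j_l = τ (2l + 3)`, this says that `i_l` and `j_{l+k-1}` are the two
ends of one arc. -/
lemma two_mul_shift_val (l : Fin (2 * k + 1)) :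
    2 * (((shift k l - 1).val : ℕ) : ZMod (2 * k + 1)) + 3 = 2 * (l.val : ZMod (2 * k + 1)) := by
  have h0 : ((2 * k + 1 : ℕ) : ZMod (2 * k + 1)) = 0 := ZMod.natCast_self _
  rw [← ofNat_val_add_shift_sub_one]
  simp only [Fin.ofNat, ZMod.natCast_mod]
  push_cast at h0 ⊢
  linear_combination 3 * h0

/-- By `start_between` the start following that of arc `l` belongs to arc `l + 2`, and by
`end_between` arc `l + 3` ends between these two starts. As 2 generates the integers modulo `2k +
1`, the starts of arcs 0, 2, 4, … make one full turn. -/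
lemma isAdmissible (h : ArcSystem (fun l => (σ l).val) (fun l => (τ l).val)) (hk : 2 ≤ k)
    (hr : ∀ l, Right (fun l => (σ l).val) (fun l => (τ l).val) l) (hne : ∀ l, σ l ≠ τ l) :
    IsAdmissible k (fun l => σ (2 * (l.val : ZMod (2 * k + 1))))
      (fun l => τ (2 * (l.val : ZMod (2 * k + 1)) + 3)) := by
  have hsys := h.rotate (σ 0)
  set s : ZMod (2 * k + 1) → ℕ := fun l => (σ l - σ 0).val with hs
  set t : ZMod (2 * k + 1) → ℕ := fun l => (τ l - σ 0).val with ht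
  have s0 : s 0 = 0 := sub_self_val _
  have hstart : ∀ l p, ¬ ArcDisj (s p) (s p) (s l) (s (l + 2)) → p = l ∨ p = l + 2 := by
    intro l p hp
    refine (h.rotate (σ l)).start_between hk l p (sub_self_val _) ((right_rotate _ _).2 (hr l)) ?_
    rw [arcDisj_rotate]
    rwa [hs, arcDisj_rotate] at hp
  have hend : ∀ l, ¬ ArcDisj (t (l + 3)) (t (l + 3)) (s l) (s (l + 2)) ∧ t (l + 3) ≠ s (l + 2) := by
    intro l
    have h1 := (h.rotate (σ l)).end_between hk l (sub_self_val _) ((right_rotate _ _).2 (hr l))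
    rw [arcDisj_rotate] at h1
    rw [hs, ht, arcDisj_rotate]
    refine ⟨h1.1, fun heq => h1.2 ?_⟩
    have h2 : NeZero n := ⟨by have := (σ 0).isLt; omega⟩
    rw [(sub_left_injective (Fin.ext heq) : τ (l + 3) = σ (l + 2))]
  have hinc : ∀ m : ℕ, m < 2 * k → s (2 * m) < s (2 * m + 2) := by
    intro m hm
    have hne2 : s (2 * m) ≠ s (2 * m + 2) := fun heq => ne_add hk _ (hsys.start_inj hk heq)
    by_contra hcon
    -- If the start did not increase, the step would pass over the cut, where arc 0 starts; so 0
    -- would be `2m` or `2m + 2`.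
    rcases hstart (2 * m) 0 (by rw [s0]; unfold ArcDisj; omega) with h1 | h1
    · rw [← h1, s0] at hcon hne2
      omega
    · have h2 : ((2 * (m + 1) : ℕ) : ZMod (2 * k + 1)) = 0 := by
        push_cast
        linear_combination -h1
      rw [ZMod.natCast_eq_zero_iff] at h2
      have h3 : Nat.Coprime (2 * k + 1) 2 := by simp
      exact absurd (Nat.le_of_dvd (by omega) (h3.dvd_of_dvd_mul_left h2)) (by omega)
  have hbet : ∀ m : ℕ, m < 2 * k →
      s (2 * m) ≤ t (2 * m + 3) ∧ t (2 * m + 3) < s (2 * m + 2) := by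
    intro m hm
    have h1 := hinc m hm
    have h2 := hend (2 * m)
    unfold ArcDisj at h2
    omega
  have hlast : s (2 * (2 * k : ℕ)) ≤ t (2 * (2 * k : ℕ) + 3) := by
    have h2 := hend (2 * (2 * k : ℕ))
    have h3 : (2 * (2 * k : ℕ) : ZMod (2 * k + 1)) + 2 = 0 := by
      have : ((2 * k + 1 : ℕ) : ZMod (2 * k + 1)) = 0 := ZMod.natCast_self _
      push_cast at this ⊢
      linear_combination 2 * this
    have h4 : s (2 * (2 * k : ℕ)) ≠ 0 := by
      intro heq
      have h5 := hsys.start_inj hk (heq.trans s0.symm)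
      exact ne_add hk 0 (by rw [zero_add, ← h3, h5, zero_add])
    rw [h3, s0] at h2
    unfold ArcDisj at h2
    omega
  have hle : ∀ m : ℕ, m ≤ 2 * k → s (2 * m) ≤ t (2 * m + 3) := by
    intro m hm
    rcases hm.lt_or_eq with h1 | rfl
    · exact (hbet m h1).1
    · exact hlast
  have hlt : ∀ m m' : ℕ, m < m' → m' ≤ 2 * k → t (2 * m + 3) < s (2 * m') := by
    intro m m' hm
    induction m', hm using Nat.le_induction with
    | base =>
      intro h1
      have := (hbet m (by omega)).2
      push_cast
      rwa [mul_add, mul_one]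
    | succ q hq ih =>
      intro h1
      have h2 := ih (by omega)
      have h3 := hinc q (by omega)
      push_cast
      rw [mul_add, mul_one]
      omega
  have hzero : σ (2 * (((0 : Fin (2 * k + 1)).val : ℕ) : ZMod (2 * k + 1))) = σ 0 := by simp
  refine ⟨by omega, fun l => ?_, fun l l' hl => ?_, fun l => ?_⟩
  · simp only [hzero]
    exact hle l.val (by omega)
  · simp only [hzero]
    exact hlt l.val l'.val hl (by omega)
  · simp only [two_mul_shift_val]
    exact hne _

end ArcSystem

end ArcsOfEdges

variable {n : ℕ}

/-! ### Cycles of length at least five -/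

section LongCycles

variable {k : ℕ}

lemma ArcSystem.neg {s t : ZMod (2 * k + 1) → ℕ} (h : ArcSystem s t) :
    ArcSystem (fun l => s (-l)) (fun l => t (-l)) := fun l l' => by
  rw [h]
  constructor
  · rintro (h1 | h1)
    · exact Or.inr (by linear_combination h1)
    · exact Or.inl (by linear_combination h1)
  · rintro (h1 | h1)
    · exact Or.inr (by linear_combination h1)
    · exact Or.inl (by linear_combination h1)

lemma two_mul_val_injective :
    Function.Injective fun l : Fin (2 * k + 1) => 2 * (l.val : ZMod (2 * k + 1)) := by
  have h0 : ((2 * k + 1 : ℕ) : ZMod (2 * k + 1)) = 0 := ZMod.natCast_self _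
  push_cast at h0
  intro l m h
  have h1 : (l.val : ZMod (2 * k + 1)) = m.val := by
    simp only at h
    linear_combination ((m.val : ZMod (2 * k + 1)) - l.val) * -h0 - k * h
  rw [ZMod.natCast_eq_natCast_iff'] at h1
  rwa [Nat.mod_eq_of_lt l.isLt, Nat.mod_eq_of_lt m.isLt, ← Fin.ext_iff] at h1

lemma mkEdge_congr {a b a' b' : Fin n} (h : a ≠ b) (ha : a = a') (hb : b = b') :
    mkEdge a b h = mkEdge a' b' (ha ▸ hb ▸ h) := by
  subst ha hb; rfl

lemma ArcSystem.exists_isAdmissible {σ τ : ZMod (2 * k + 1) → Fin n}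
    (h : ArcSystem (fun l => (σ l).val) (fun l => (τ l).val)) (hk : 2 ≤ k)
    (hne : ∀ l, σ l ≠ τ l) :
    ∃ (i j : Fin (2 * k + 1) → Fin n) (hij : IsAdmissible k i j)
      (φ : Fin (2 * k + 1) → ZMod (2 * k + 1)), Function.Injective φ ∧
        ∀ l, hij.edge ∅ l = mkEdge (σ (φ l)) (τ (φ l)) (hne _) := by
  by_cases hr : ∃ l, ArcSystem.Right (fun l => (σ l).val) (fun l => (τ l).val) l
  · obtain ⟨l, hl⟩ := hr
    refine ⟨_, _, h.isAdmissible hk (h.right_all hk hl) hne, _, two_mul_val_injective, fun l => ?_⟩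
    refine mkEdge_congr _ ?_ ?_
    · simp [leftEnd]
    · simp [rightEnd, ArcSystem.two_mul_shift_val]
  -- Arcs `l` and `l + 2` meet, so if no arc contains the start of the second next one, then each
  -- contains the start of the second previous one. Reversing the numbering reduces to the first
  -- case.
  · push Not at hr
    have h' : ArcSystem (fun l => (σ (-l)).val) (fun l => (τ (-l)).val) := h.neg
    have hr' : ∀ l, ArcSystem.Right (fun l => (σ (-l)).val) (fun l => (τ (-l)).val) l := by
      intro l
      have h1 := hr (-(l + 2))
      have h2 := h.not_disj_two hk (-(l + 2))
      unfold ArcSystem.Right at *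
      rw [show -(l + 2) + 2 = -l by ring] at h1 h2
      beta_reduce at *
      unfold ArcDisj at *
      omega
    refine ⟨_, _, h'.isAdmissible hk hr' fun l => hne _, _,
      neg_injective.comp two_mul_val_injective, fun l => ?_⟩
    refine mkEdge_congr _ ?_ ?_
    · simp [leftEnd]
    · simp [rightEnd, ArcSystem.two_mul_shift_val]

lemma sum_single_le {σ ι : Type*} [Fintype ι] {e : ι → σ} (he : Function.Injective e)
    {u : σ →₀ ℕ} (hu : ∀ l, u (e l) ≠ 0) : ∑ l, Finsupp.single (e l) 1 ≤ u := by
  classical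
  intro s
  rw [Finsupp.finsetSum_apply]
  by_cases hs : ∃ l, e l = s
  · obtain ⟨l, rfl⟩ := hs
    rw [Finset.sum_eq_single l]
    · have := hu l
      simp
      omega
    · intro m _ hm
      rw [Finsupp.single_apply, if_neg fun h => hm (he h)]
    · simp
  · rw [Finset.sum_eq_zero fun l _ => by rw [Finsupp.single_apply, if_neg fun h => hs ⟨l, h⟩]]
    exact Nat.zero_le _

lemma cycle_injective (hk : 2 ≤ k) {c : ZMod (2 * k + 1) → Edge n}
    (hc : ∀ l l', Sep (c l) (c l') ↔ l' = l + 1 ∨ l = l' + 1) : Function.Injective c := by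
  intro l m h
  by_contra hlm
  have h1 := (hc l (l + 1)).2 (Or.inl rfl)
  have h2 := (hc l (l - 1)).2 (Or.inr (by ring))
  rw [h, hc] at h1 h2
  have h3 : m = l + 2 := by
    rcases h1 with h1 | h1
    · exact absurd (by linear_combination h1) hlm
    · linear_combination h1
  have h4 : l = m + 2 := by
    rcases h2 with h2 | h2
    · linear_combination h2
    · exact absurd (by linear_combination -h2) hlm
  exact zmod_natCast_ne_zero (N := 2 * k + 1) (a := 4) (by omega) (by omega)
    (by push_cast; linear_combination -h3 - h4)

lemma exists_isAdmissible_of_cycle (hk : 2 ≤ k) {c : ZMod (2 * k + 1) → Edge n}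
    (hc : ∀ l l', Sep (c l) (c l') ↔ l' = l + 1 ∨ l = l' + 1) {u : Edge n →₀ ℕ}
    (hu : ∀ l, u (c l) ≠ 0) :
    ∃ (i j : Fin (2 * k + 1) → Fin n) (hij : IsAdmissible k i j), hij.exponent ∅ ≤ u := by
  obtain ⟨i, j, hij, φ, hφ, he⟩ :=
    (arcSystem_of_sep hk hc).exists_isAdmissible hk fun l => arcStart_ne_arcStop _ _
  refine ⟨i, j, hij, ?_⟩
  simp only [mkEdge_arc] at he
  refine sum_single_le (fun l l' h => ?_) fun l => by rw [he]; exact hu _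
  rw [he, he] at h
  exact hφ (cycle_injective hk hc h)

end LongCycles

/-! ### Three pairwise separated edges -/

section Triangles

/-- The product of the three edges is the leading monomial of a master polynomial or of an
off-diagonal minor. -/
def IsLeading (m : MonomialOrder (Edge n)) (e f g : Edge n) : Prop :=
  ∃ p ∈ masterPolynomials n ∪ offDiagonalMinors n, p ≠ 0 ∧
    m.degree p = Finsupp.single e 1 + Finsupp.single f 1 + Finsupp.single g 1

variable {m : MonomialOrder (Edge n)}

lemma IsLeading.swap {e f g : Edge n} (h : IsLeading m e f g) : IsLeading m f e g := by
  obtain ⟨p, hp, h0, h1⟩ := h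
  exact ⟨p, hp, h0, by rw [h1]; abel⟩

lemma IsLeading.rotate {e f g : Edge n} (h : IsLeading m e f g) : IsLeading m f g e := by
  obtain ⟨p, hp, h0, h1⟩ := h
  exact ⟨p, hp, h0, by rw [h1]; abel⟩

lemma isLeading_of_triangle (hm : IsCircular m) {a b c d e f : Fin n} (hab : a ≠ b) (hcd : c ≠ d)
    (hef : e ≠ f) (h1 : (b - a).val < (c - a).val) (h2 : (c - a).val < (d - a).val)
    (h3 : (d - a).val < (e - a).val) (h4 : (e - a).val < (f - a).val) :
    IsLeading m (mkEdge a b hab) (mkEdge c d hcd) (mkEdge e f hef) := by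
  have hadm : IsAdmissible 1 ![a, c, e] ![b, d, f] := by
    refine ⟨le_rfl, fun l => ?_, fun l l' hl => ?_, fun l => ?_⟩
    · fin_cases l
      · simp [sub_val]
      · exact h2.le
      · exact h4.le
    · fin_cases l <;> fin_cases l'
      all_goals first
        | exact absurd hl (by decide)
        | skip
      · exact h1
      · exact h1.trans (h2.trans h3)
      · exact h3
    · fin_cases l
      · exact hab
      · exact hcd
      · exact hef
  refine ⟨_, Or.inl ⟨1, _, _, hadm, rfl⟩, hadm.masterPolynomial_ne_zero, ?_⟩
  rw [hadm.degree_masterPolynomial hm, IsAdmissible.exponent]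
  exact Fin.sum_univ_three _

lemma edgeClass_mkEdge_of_lt {z a b : Fin n} (hab : a ≠ b) (h : (a - z).val < (b - z).val) :
    edgeClass (mkEdge a b hab) =
      min ((b - z).val - (a - z).val) (n - ((b - z).val - (a - z).val)) := by
  rw [edgeClass_mkEdge, sub_val_eq_of_lift (z := z) (q := 0) (r := 0) (by omega)
    (by have := (b - z).isLt; omega)]
  simp

lemma isLeading_of_parallel (hm : IsCircular m) {a b : Fin 3 → Fin n} (h : ∀ s t, a s ≠ b t)
    (h1 : (a 0 - a 0).val < (a 1 - a 0).val) (h2 : (a 1 - a 0).val < (a 2 - a 0).val)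
    (h3 : (a 2 - a 0).val < (b 2 - a 0).val) (h4 : (b 2 - a 0).val < (b 1 - a 0).val)
    (h5 : (b 1 - a 0).val < (b 0 - a 0).val) :
    IsLeading m (mkEdge (a 0) (b 0) (h _ _)) (mkEdge (a 1) (b 1) (h _ _))
      (mkEdge (a 2) (b 2) (h _ _)) := by
  have hne : ∀ {x y : Fin n}, (x - a 0).val < (y - a 0).val → x ≠ y := by
    rintro x _ h rfl
    exact lt_irrefl _ h
  have ha : Function.Injective a := by
    intro s t hst
    have e1 := hne h1
    have e2 := hne h2
    have e3 := hne (h1.trans h2)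
    fin_cases s <;> fin_cases t <;> simp_all
  have hb : Function.Injective b := by
    intro s t hst
    have e1 := hne h4
    have e2 := hne h5
    have e3 := hne (h4.trans h5)
    fin_cases s <;> fin_cases t <;> simp_all
  have hlt : ∀ s t, (a s - a 0).val < (b t - a 0).val := by
    intro s t
    fin_cases s <;> fin_cases t <;> simp only [Fin.zero_eta, Fin.mk_one, Fin.reduceFinMk] <;> omega
  have hbd : ∀ t, (b t - a 0).val < n := fun t => (b t - a 0).isLt
  obtain ⟨p, hp, h0, hd⟩ := exists_offDiagonalMinor_degree hm ha hb h (by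
    intro s t hst
    rw [edgeClass_mkEdge_of_lt _ (hlt s s), edgeClass_mkEdge_of_lt _ (hlt t t),
      edgeClass_mkEdge_of_lt _ (hlt s t)]
    have b0 := hbd 0
    have b1 := hbd 1
    have b2 := hbd 2
    fin_cases s <;> fin_cases t <;> simp only [Fin.zero_eta, Fin.mk_one, Fin.reduceFinMk] at * <;>
      omega)
  exact ⟨p, Or.inr hp, h0, hd.trans (Fin.sum_univ_three _)⟩

lemma mkEdge_eq (e : Edge n) (h : e.1.1 ≠ e.1.2) : mkEdge e.1.1 e.1.2 h = e := by
  rw [mkEdge, dif_pos e.2]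

lemma mkEdge_eq' (e : Edge n) (h : e.1.2 ≠ e.1.1) : mkEdge e.1.2 e.1.1 h = e := by
  rw [mkEdge, dif_neg e.2.not_gt]

lemma isLeading_of_lt (hm : IsCircular m) {e f g : Edge n} (hef : Sep e f) (heg : Sep e g)
    (hfg : Sep f g) (h1 : e.1.1 < f.1.1) (h2 : f.1.1 < g.1.1) : IsLeading m e f g := by
  have he : e.1.1.val < e.1.2.val := e.2
  have hf : f.1.1.val < f.1.2.val := f.2
  have hg : g.1.1.val < g.1.2.val := g.2
  have i1 := e.1.2.isLt
  have i2 := f.1.2.isLt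
  have i3 := g.1.2.isLt
  simp only [Sep, Fin.lt_def] at *
  -- Here `e` lies between `f` and `g`: the circular order is `g.2, e.1, f.1, f.2, e.2, g.1`, which
  -- is the parallel configuration of a minor.
  have hpar : ∀ {e f g : Edge n}, (∀ s t, ![g.1.2, e.1.1, f.1.1] s ≠ ![g.1.1, e.1.2, f.1.2] t) →
      e.1.1.val < f.1.1.val → f.1.1.val < f.1.2.val → f.1.2.val < e.1.2.val →
      (g.1.2.val < e.1.1.val ∨ e.1.2.val < g.1.1.val) → IsLeading m e f g := by
    intro e f g h h1 h2 h3 h4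
    have h6 : g.1.1.val < g.1.2.val := g.2
    have i1 := e.1.2.isLt
    have i3 := g.1.2.isLt
    have h5 := isLeading_of_parallel hm h
    simp only [Matrix.cons_val_zero, Matrix.cons_val_one, Matrix.cons_val, mkEdge_eq,
      mkEdge_eq', sub_val] at h5
    refine (h5 ?_ ?_ ?_ ?_ ?_).rotate <;> split_ifs <;> omega
  rcases hef with hef | hef | hef | hef
  · by_cases hlt : f.1.2.val < g.1.1.val
    · have h5 := isLeading_of_triangle hm e.2.ne f.2.ne g.2.ne
      simp only [mkEdge_eq, sub_val] at h5
      refine h5 ?_ ?_ ?_ ?_ <;> split_ifs <;> omega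
    · refine (hpar (e := f) (f := g) (g := e) ?_ ?_ ?_ ?_ ?_).rotate.rotate
      · intro s t
        rw [Ne, Fin.ext_iff]
        fin_cases s <;> fin_cases t <;> simp <;> omega
      all_goals omega
  · omega
  · by_cases hlt : e.1.2.val < g.1.1.val
    · refine hpar (e := e) (f := f) (g := g) ?_ ?_ ?_ ?_ ?_
      · intro s t
        rw [Ne, Fin.ext_iff]
        fin_cases s <;> fin_cases t <;> simp <;> omega
      all_goals omega
    · by_cases hlt' : f.1.2.val < g.1.1.val
      -- The edge `e` encloses both others, which lie side by side; its outer arc is the third of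
      -- three disjoint arcs, so its ends are reversed.
      · have h5 := isLeading_of_triangle hm f.2.ne g.2.ne e.2.ne'
        simp only [mkEdge_eq, mkEdge_eq', sub_val] at h5
        refine (h5 ?_ ?_ ?_ ?_).rotate.rotate <;> split_ifs <;> omega
      · have h : ∀ s t, ![e.1.1, f.1.1, g.1.1] s ≠ ![e.1.2, f.1.2, g.1.2] t := by
          intro s t
          rw [Ne, Fin.ext_iff]
          fin_cases s <;> fin_cases t <;> simp <;> omega
        have h5 := isLeading_of_parallel hm h
        simp only [Matrix.cons_val_zero, Matrix.cons_val_one, Matrix.cons_val, mkEdge_eq,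
          sub_val] at h5
        refine h5 ?_ ?_ ?_ ?_ ?_ <;> split_ifs <;> omega
  · omega

lemma isLeading_of_sep (hm : IsCircular m) {e f g : Edge n} (hef : Sep e f) (heg : Sep e g)
    (hfg : Sep f g) : IsLeading m e f g := by
  have hne : ∀ {e f : Edge n}, Sep e f → e.1.1 ≠ f.1.1 := by
    intro e f h heq
    have he := e.2
    have hf := f.2
    simp only [Sep, Fin.lt_def] at *
    rw [heq] at *
    omega
  rcases (hne hef).lt_or_gt with h1 | h1 <;> rcases (hne heg).lt_or_gt with h2 | h2 <;>
    rcases (hne hfg).lt_or_gt with h3 | h3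
  · exact isLeading_of_lt hm hef heg hfg h1 h3
  · exact (isLeading_of_lt hm heg hef hfg.symm h2 h3).rotate.swap.rotate.rotate
  · exact absurd (h1.trans (h3.trans h2)) (lt_irrefl _)
  · exact (isLeading_of_lt hm heg.symm hfg.symm hef h2 h1).rotate
  · exact (isLeading_of_lt hm hef.symm hfg heg h1 h2).swap
  · exact absurd (h1.trans (h2.trans h3)) (lt_irrefl _)
  · exact (isLeading_of_lt hm hfg hef.symm heg.symm h3 h2).rotate.rotate
  · exact (isLeading_of_lt hm hfg.symm heg.symm hef.symm h3 h1).swap.rotate.rotate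

end Triangles

lemma exists_degree_le {m : MonomialOrder (Edge n)} (hm : IsCircular m) {u : Edge n →₀ ℕ}
    (hu : ∀ a b, a + b = u → Std a → Std b → False) :
    ∃ g ∈ masterPolynomials n ∪ offDiagonalMinors n, g ≠ 0 ∧ m.degree g ≤ u := by
  obtain ⟨k, hk, c, hcu, hc⟩ := exists_odd_cycle_of_not_std hu
  -- A cycle of length three is special: its nonconsecutive arcs do not exist, so the arc argument
  -- needs `k ≥ 2`.
  rcases hk.eq_or_lt with rfl | hk
  · have h01 : Sep (c 0) (c 1) := (hc _ _).2 (Or.inl rfl)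
    have h12 : Sep (c 1) (c 2) := (hc _ _).2 (Or.inl rfl)
    have h02 : Sep (c 0) (c 2) := (hc _ _).2 (Or.inr rfl)
    obtain ⟨g, hg, h0, hd⟩ := isLeading_of_sep hm h01 h02 h12
    refine ⟨g, hg, h0, ?_⟩
    have hne : ∀ {e f : Edge n}, Sep e f → e ≠ f := by
      rintro e _ h rfl
      exact Sep.irrefl _ h
    have h1 := sum_single_le (e := ![c 0, c 1, c 2]) (u := u) (by
      have e1 := hne h01
      have e2 := hne h12
      have e3 := hne h02
      intro s t hst
      fin_cases s <;> fin_cases t <;> simp_all) (by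
      intro s
      fin_cases s
      · exact hcu 0
      · exact hcu 1
      · exact hcu 2)
    rw [hd]
    refine le_trans (le_of_eq ?_) h1
    rw [Fin.sum_univ_three]
    rfl
  · obtain ⟨i, j, hij, hle⟩ := exists_isAdmissible_of_cycle hk hc hcu
    exact ⟨_, Or.inl ⟨k, i, j, hij, rfl⟩, hij.masterPolynomial_ne_zero,
      by rwa [hij.degree_masterPolynomial hm]⟩

end SecondHypersimplex

end

theorem mainTheorem1 (n : ℕ) :
    (∀ m : MonomialOrder (SecondHypersimplex.Edge n), SecondHypersimplex.IsCircular m →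
      SecondHypersimplex.IsDelightful m 2 (SecondHypersimplex.toricIdeal n) ∧
      SecondHypersimplex.IsGroebnerBasis m
        (SecondHypersimplex.masterPolynomials n ∪ SecondHypersimplex.offDiagonalMinors n)
        (SecondHypersimplex.secantIdeal 2 (SecondHypersimplex.toricIdeal n))) ∧
    MvPolynomial.totalDegree ''
        (SecondHypersimplex.masterPolynomials n ∪ SecondHypersimplex.offDiagonalMinors n) =
      {d : ℕ | Odd d ∧ 3 ≤ d ∧ d ≤ n ∧ (d = 3 → 6 ≤ n)} :=
  ⟨fun _ hm => SecondHypersimplex.isDelightful_and_isGroebnerBasis hm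
    (SecondHypersimplex.finite_masterPolynomials_union n)
    (SecondHypersimplex.masterPolynomials_union_subset n)
    fun _ hu => SecondHypersimplex.exists_degree_le hm hu,
    SecondHypersimplex.totalDegree_image n⟩
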